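/- **Setting.** Let $\Bbbk$ be a commutative ring, $A$ an associative unital $\Bbbk$-algebra and $\Omega_d^\bullet$ an exterior algebra over $A$: a differential graded $\Bbbk$-algebra with $\Omega_d^0=A$ in which $\Omega_d^n$ is spanned by the forms $a_0\,da_1\wedge\cdots\wedge da_n$. For a left $A$-module $E$ put $\Omega^n_dE=\Omega^n_d\otimes_A E$. - *Jets.* $J^1_dE=(A\otimes E)/N_dE$, where $N_dE$ is spanned by the elements $\sum_i a_i\otimes b_ie$ with $\sum_i a_ib_i=0$ and $\sum_i a_i\,db_i=0$; write $j^1(e)=[1\otimes e]$, $\pi^{1,0}[a\otimes e]=ae$ and $\iota^1\colon\Omega^1_dE\to J^1_dE$, $a\,db\otimes e\mapsto[a\otimes be]-[ab\otimes e]$. Let $(\Omega^1_d\ltimes\Omega^2_d)E=\Omega^1_dE\oplus\Omega^2_dE$ with the left action $a(\alpha+\beta)=a\alpha+da\wedge\alpha+a\beta$, and let $\widetilde D\colon J^1_dJ^1_dE\to(\Omega^1_d\ltimes\Omega^2_d)E$, $[a\otimes b]\otimes[c\otimes e]\mapsto a\,d(bc)\otimes e+da\wedge d(bc)\otimes e$.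 Put $J^0_dE=E$ and, for $n\ge 2$, $J^n_dE=\ker\big(J^1_dJ^{n-1}_dE\to J^1_dJ^1_dJ^{n-2}_dE\xrightarrow{\widetilde D}(\Omega^1_d\ltimes\Omega^2_d)J^{n-2}_dE\big)$. With the inclusions $l\colon J^{n}_dE\to J^1_dJ^{n-1}_dE$ one has the projections $\pi^{n,n-1}=\pi^{1,0}\circ l$ and the prolongations $j^n\colon E\to J^n_dE$, $l\circ j^{n}=j^1\circ j^{n-1}$, $j^0=\mathrm{id}$. - *Symmetric forms.* $S^0_dE=E$, $S^1_dE=\Omega^1_dE$ and, for $n\ge2$, $S^n_dE=\ker\big(\Omega^1_dS^{n-1}_dE\to\Omega^1_d\Omega^1_dS^{n-2}_dE\xrightarrow{\wedge}\Omega^2_dS^{n-2}_dE\big)$, with inclusions $\iota^{n}_{\wedge,E}\colon S^{n}_dE\to\Omega^1_dS^{n-1}_dE$ and $\iota^n\colon S^n_dE\to J^n_dE$ given by $\iota^0=\mathrm{id}$, $l\circ\iota^{n}=\iota^1\circ\Omega^1_d(\iota^{n-1})\circ\iota^{n}_{\wedge,E}$. - *Operators and symbols.* $\mathrm{Diff}^n_d(E,F)$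 is the set of maps $\Delta=\widetilde\Delta\circ j^n$ with $\widetilde\Delta\colon J^n_dE\to F$ left $A$-linear, $\mathrm{Diff}_d=\bigcup_n\mathrm{Diff}^n_d$, and $\mathrm{Symb}^n_d(E,F)=\mathrm{Diff}^n_d(E,F)/\mathrm{Diff}^{n-1}_d(E,F)$ with $\mathrm{Diff}^{-1}_d=0$. A *natural $n$-quantization* for $E$ is a $\Bbbk$-linear section $q^n_F$ of $\mathrm{Diff}^n_d(E,F)\to\mathrm{Symb}^n_d(E,F)$, natural in the left $A$-module $F$. A *natural full quantization* is the sum $q=\sum_nq^n\colon\bigoplus_n\mathrm{Symb}^n_d(E,-)\to\mathrm{Diff}_d(E,-)$ of natural $n$-quantizations, one for each $n\ge 0$. - *Connections.* A left connection on $E$ is an additive map $\nabla^E\colon E\to\Omega^1_dE$ with $\nabla^E(ae)=a\nabla^E e+da\otimes e$ (it is then $\Bbbk$-linear). A bimodule connection on $\Omega^1_d$ is a left connection $\nabla$ on $\Omega^1_d$ with a bimodule map $\sigma\colon\Omega^1_d\otimes_A\Omega^1_d\to\Omega^1_d\otimes_A\Omega^1_d$ such that $\nabla(\omega a)=\nabla(\omega)a+\sigma(\omega\otimes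 da)$. With a left connection $\nabla^F$ on $F$ it gives the left connection $\nabla^{\Omega^1_dF}(\omega\otimes f)=\nabla(\omega)\otimes f+(\sigma\otimes\mathrm{id}_F)(\omega\otimes\nabla^Ff)$ on $\Omega^1_dF$. **Corollary 5.18.** Let $E$ be a left $A$-module such that, for all $n$, $J^n_dE$ is elemental, i.e. generated as a left $A$-module by $j^n(E)$, and such that for all $n\ge1$ the $n$-jet sequence $S^n_dE\xrightarrow{\iota^n}J^n_dE\xrightarrow{\pi^{n,n-1}}J^{n-1}_dE\to0$ is exact. Let $\nabla^{\Omega^1_d}$ be a bimodule connection on $\Omega^1_d$ and $\nabla^E$ a left connection on $E$. 1. Let $s^{1,n}_E\colon\Omega^1_dS^n_dE\to S^{n+1}_dE$, $n\ge0$, be left $A$-linear retractions of $\iota^{n+1}_{\wedge,E}$. Then there are left connections $\nabla^{S^n_dE}$ on all $S^n_dE$ with $\nabla^{S^0_dE}=\nabla^E$ and $\nabla^{S^{n+1}_dE}=\Omega^1_d(s^{1,n}_E)\circ\nabla^{\Omega^1_dS^n_dE}\circ\iota^{n+1}_{\wedge,E}$, and there is a natural full quantization $q=\sum_n q^n$ for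 $E$ such that, for every left $A$-linear $\widetilde\Delta\colon J^n_dE\to F$, $$q^n_F\big([\widetilde\Delta\circ j^n]\big)=\widetilde\Delta\circ\iota^n\circ s^{1,n-1}_E\circ\nabla^{S^{n-1}_dE}\circ\cdots\circ s^{1,0}_E\circ\nabla^{E}.$$ 2. Let $s^{1,n}\colon\Omega^1_dS^n_dA\to S^{n+1}_dA$, $n\ge0$, be $A$-bimodule retractions of $\iota^{n+1}_{\wedge,A}$, and suppose that the canonical maps $S^n_dA\otimes_AE\to S^n_dE$ are surjective. Then for all $n$ there is exactly one left $A$-linear map $s^{1,n}\otimes_A\mathrm{id}_E\colon\Omega^1_dS^n_dE\to S^{n+1}_dE$ compatible with $s^{1,n}$ along the maps induced by $A\to E$, $a\mapsto ae$, for all $e\in E$; these maps are retractions of $\iota^{n+1}_{\wedge,E}$, and so, as in part 1, they induce left connections on all $S^n_dE$ and a natural full quantization for $E$. -/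

import Mathlib

open scoped TensorProduct DirectSum

universe w u

noncomputable section

namespace NCJet

/-! ### Tensor products over a noncommutative ring -/

section Tensor

variable {A : Type u} [Ring A]

/-- The relations `(m a) ⊗ e - m ⊗ (a e)`. -/
def balRel (A : Type u) [Ring A] (M E : Type u) [AddCommGroup M] [Module A M] [Module Aᵐᵒᵖ M]
    [SMulCommClass A Aᵐᵒᵖ M] [AddCommGroup E] [Module A E] : Submodule A (M ⊗[ℤ] E) :=
  Submodule.span A {x | ∃ (m : M) (a : A) (e : E),
    x = (MulOpposite.op a • m) ⊗ₜ[ℤ] e - m ⊗ₜ[ℤ] (a • e)}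

/-- The left `A`-module `M ⊗_A E`, for an `A`-bimodule `M` and a left `A`-module `E`. -/
def BT (A : Type u) [Ring A] (M E : Type u) [AddCommGroup M] [Module A M] [Module Aᵐᵒᵖ M]
    [SMulCommClass A Aᵐᵒᵖ M] [AddCommGroup E] [Module A E] : Type u :=
  (M ⊗[ℤ] E) ⧸ balRel A M E

namespace BT

variable {M E F G : Type u} [AddCommGroup M] [Module A M] [Module Aᵐᵒᵖ M]
  [SMulCommClass A Aᵐᵒᵖ M] [AddCommGroup E] [Module A E] [AddCommGroup F] [Module A F]
  [AddCommGroup G] [Module A G]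

instance : AddCommGroup (BT A M E) := Submodule.Quotient.addCommGroup (balRel A M E)
instance : Module A (BT A M E) := Submodule.Quotient.module (balRel A M E)

/-- The elementary tensor `m ⊗_A e`. -/
def tmul (A : Type u) [Ring A] {M E : Type u} [AddCommGroup M] [Module A M] [Module Aᵐᵒᵖ M]
    [SMulCommClass A Aᵐᵒᵖ M] [AddCommGroup E] [Module A E] (m : M) (e : E) : BT A M E :=
  (balRel A M E).mkQ (m ⊗ₜ[ℤ] e)

theorem add_tmul (m m' : M) (e : E) : tmul A (m + m') e = tmul A m e + tmul A m' e := by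
  simp only [tmul, TensorProduct.add_tmul]; exact map_add _ _ _

theorem tmul_add (m : M) (e e' : E) : tmul A m (e + e') = tmul A m e + tmul A m e' := by
  simp only [tmul, TensorProduct.tmul_add]; exact map_add _ _ _

theorem smul_tmul' (a : A) (m : M) (e : E) : a • tmul A m e = tmul A (a • m) e :=
  ((balRel A M E).mkQ.map_smul a (m ⊗ₜ[ℤ] e)).symm

theorem tmul_smul (m : M) (a : A) (e : E) :
    tmul A m (a • e) = tmul A (MulOpposite.op a • m) e :=
  ((Submodule.Quotient.eq (balRel A M E)).2 (Submodule.subset_span ⟨m, a, e, rfl⟩)).symm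

theorem zero_tmul (e : E) : tmul A (0 : M) e = 0 := by
  simp only [tmul, TensorProduct.zero_tmul]; exact map_zero (balRel A M E).mkQ

/-- `e ↦ (m ↦ m ⊗_A e)`. -/
def mk : E →+ (M →ₗ[A] BT A M E) where
  toFun e :=
    { toFun := fun m => tmul A m e
      map_add' := fun m m' => add_tmul m m' e
      map_smul' := fun a m => (smul_tmul' a m e).symm }
  map_zero' := by
    ext m
    simp only [tmul, TensorProduct.tmul_zero]; exact map_zero (balRel A M E).mkQ
  map_add' e e' := by ext m; exact tmul_add m e e'

@[simp] theorem mk_apply (e : E) (m : M) : mk (A := A) e m = tmul A m e := rfl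

theorem induction {p : BT A M E → Prop} (x : BT A M E) (h0 : p 0)
    (ht : ∀ m e, p (tmul A m e)) (ha : ∀ x y, p x → p y → p (x + y)) : p x := by
  obtain ⟨y, rfl⟩ := (balRel A M E).mkQ_surjective x
  induction y using TensorProduct.induction_on with
  | zero => rw [map_zero]; exact h0
  | tmul m e => exact ht m e
  | add x y hx hy => rw [map_add]; exact ha _ _ hx hy

/-- The additive map on `M ⊗_A E` induced by a balanced biadditive map. -/
def liftAdd {G : Type u} [AddCommGroup G] (f : M →+ E →+ G)
    (hf : ∀ (m : M) (a : A) (e : E), f (MulOpposite.op a • m) e = f m (a • e)) : BT A M E →+ G :=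
  QuotientAddGroup.lift (balRel A M E).toAddSubgroup
    (TensorProduct.liftAddHom f (fun r m e => by rw [map_zsmul, map_zsmul]; rfl))
    (by
      intro x hx
      have key : ∀ x ∈ balRel A M E, ∀ a : A, (TensorProduct.liftAddHom (R := ℤ) f
          (fun r m e => by rw [map_zsmul, map_zsmul]; rfl)) (a • x) = 0 := by
        intro x hx
        induction hx using Submodule.span_induction with
        | mem x h =>
          obtain ⟨m, b, e, rfl⟩ := h
          intro a
          rw [smul_sub, TensorProduct.smul_tmul', TensorProduct.smul_tmul', map_sub,
            TensorProduct.liftAddHom_tmul, TensorProduct.liftAddHom_tmul, smul_comm, hf, sub_self]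
        | zero => intro a; rw [smul_zero, map_zero]
        | add x y _ _ hx hy => intro a; rw [smul_add, map_add, hx, hy, add_zero]
        | smul r x _ hx => intro a; rw [smul_smul]; exact hx _
      have := key x hx 1
      rwa [one_smul] at this)

@[simp] theorem liftAdd_tmul {G : Type u} [AddCommGroup G] (f : M →+ E →+ G)
    (hf : ∀ (m : M) (a : A) (e : E), f (MulOpposite.op a • m) e = f m (a • e)) (m : M) (e : E) :
    liftAdd (A := A) f hf (tmul A m e) = f m e := rfl

/-- The left `A`-linear map on `M ⊗_A E` induced by a balanced biadditive map which is left
`A`-linear in the first variable. -/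
def lift (f : E →+ (M →ₗ[A] G)) (hf : ∀ (m : M) (a : A) (e : E), f e (MulOpposite.op a • m) = f (a • e) m) :
    BT A M E →ₗ[A] G where
  toFun := liftAdd (A := A) (AddMonoidHom.flip
    { toFun := fun e => (f e).toAddMonoidHom
      map_zero' := by ext m; simp
      map_add' := fun e e' => by ext m; simp }) hf
  map_add' := map_add _
  map_smul' a x := by
    induction x using BT.induction with
    | h0 => simp
    | ht m e => rw [smul_tmul']; exact (f e).map_smul a m
    | ha x y hx hy => simp only [smul_add, map_add, hx, hy]

@[simp] theorem lift_tmul (f : E →+ (M →ₗ[A] G))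
    (hf : ∀ (m : M) (a : A) (e : E), f e (MulOpposite.op a • m) = f (a • e) m) (m : M) (e : E) :
    lift f hf (tmul A m e) = f e m := rfl

/-- `id_M ⊗_A g`. -/
def map (M : Type u) [AddCommGroup M] [Module A M] [Module Aᵐᵒᵖ M] [SMulCommClass A Aᵐᵒᵖ M]
    (g : E →ₗ[A] F) : BT A M E →ₗ[A] BT A M F :=
  lift (mk.comp g.toAddMonoidHom) (fun m a e => by
    change tmul A _ (g e) = tmul A m (g (a • e))
    rw [map_smul, tmul_smul])

@[simp] theorem map_tmul (g : E →ₗ[A] F) (m : M) (e : E) :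
    map M g (tmul A m e) = tmul A m (g e) := rfl

end BT

/-- The `A`-linear map `A ⊗ E → G`, `a ⊗ e ↦ a f(e)`. -/
def extend {E G : Type u} [AddCommGroup E] [Module A E] [AddCommGroup G] [Module A G]
    (f : E →+ G) : A ⊗[ℤ] E →ₗ[A] G where
  toFun := TensorProduct.liftAddHom (R := ℤ)
    { toFun := fun a => (DistribSMul.toAddMonoidHom G a).comp f
      map_zero' := by ext; simp
      map_add' := fun a b => by ext; simp [add_smul] }
    (fun r a e => by
      change (r • a) • f e = a • f (r • e)
      rw [map_zsmul, smul_assoc, smul_comm])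
  map_add' := map_add _
  map_smul' a x := by
    induction x using TensorProduct.induction_on with
    | zero => simp
    | tmul b e => simp [TensorProduct.smul_tmul', mul_smul]
    | add x y hx hy => simp only [smul_add, map_add, hx, hy]

@[simp] theorem extend_tmul {E G : Type u} [AddCommGroup E] [Module A E] [AddCommGroup G]
    [Module A G] (f : E →+ G) (a : A) (e : E) : extend (A := A) f (a ⊗ₜ[ℤ] e) = a • f e := rfl

end Tensor

/-! ### Exterior algebras -/

/-- An exterior algebra `Ω^•` over the `k`-algebra `A`: a differential graded `k`-algebra with
`Ω^0 = A`, in which every `Ω^n` is spanned by the forms `a₀ da₁ ∧ ⋯ ∧ daₙ`. -/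
structure ExteriorCalculus (k : Type w) (A Ω : Type u) [CommRing k] [Ring A] [Algebra k A]
    [Ring Ω] [Algebra k Ω] where
  deg : ℕ → Submodule k Ω
  graded : GradedAlgebra deg
  incl : A →ₐ[k] Ω
  incl_injective : Function.Injective incl
  range_incl : LinearMap.range incl.toLinearMap = deg 0
  d : Ω →ₗ[k] Ω
  d_mem : ∀ {n : ℕ} {x : Ω}, x ∈ deg n → d x ∈ deg (n + 1)
  d_d : ∀ x : Ω, d (d x) = 0
  leibniz : ∀ {n : ℕ} {x : Ω}, x ∈ deg n → ∀ y : Ω, d (x * y) = d x * y + (-1) ^ n * (x * d y)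
  surj : ∀ n : ℕ, deg n = Submodule.span k {x | ∃ (a₀ : A) (a : Fin n → A),
    x = incl a₀ * (List.ofFn fun i => d (incl (a i))).prod}

variable {k : Type w} {A Ω : Type u} [CommRing k] [Ring A] [Algebra k A] [Ring Ω] [Algebra k Ω]

namespace ExteriorCalculus

variable (C : ExteriorCalculus k A Ω)

/-- The `A`-bimodule `Ω^n` of `n`-forms. -/
def Form (n : ℕ) : Type u := C.deg n

namespace Form

variable {C} {n : ℕ}

instance : AddCommGroup (C.Form n) := Submodule.addCommGroup (C.deg n)

/-- The underlying element of the differential graded algebra. -/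
def val : C.Form n →+ Ω := (C.deg n).subtype.toAddMonoidHom

@[ext] theorem ext {x y : C.Form n} (h : val x = val y) : x = y := Subtype.ext h

theorem val_mem (x : C.Form n) : val x ∈ C.deg n := x.2

/-- The `n`-form given by an element of degree `n`. -/
def of (x : Ω) (hx : x ∈ C.deg n) : C.Form n := ⟨x, hx⟩

@[simp] theorem val_of (x : Ω) (hx : x ∈ C.deg n) : val (of (C := C) x hx) = x := rfl

end Form

theorem incl_mem (a : A) : C.incl a ∈ C.deg 0 := by
  rw [← C.range_incl]; exact ⟨a, rfl⟩

theorem mul_mem {m n : ℕ} {x y : Ω} (hx : x ∈ C.deg m) (hy : y ∈ C.deg n) :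
    x * y ∈ C.deg (m + n) :=
  haveI := C.graded
  SetLike.mul_mem_graded hx hy

namespace Form

variable {C} {n : ℕ}

instance : SMul A (C.Form n) :=
  ⟨fun a x => of (C.incl a * val x) (by simpa using C.mul_mem (C.incl_mem a) (val_mem x))⟩

instance : SMul Aᵐᵒᵖ (C.Form n) :=
  ⟨fun a x => of (val x * C.incl a.unop) (C.mul_mem (val_mem x) (C.incl_mem a.unop))⟩

@[simp] theorem val_smul (a : A) (x : C.Form n) : val (a • x) = C.incl a * val x := rfl

@[simp] theorem val_op_smul (a : Aᵐᵒᵖ) (x : C.Form n) : val (a • x) = val x * C.incl a.unop := rfl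

instance : Module A (C.Form n) where
  one_smul x := by ext; simp
  mul_smul a b x := by ext; simp [mul_assoc]
  smul_zero a := by ext; simp
  smul_add a x y := by ext; simp [mul_add]
  add_smul a b x := by ext; simp [add_mul]
  zero_smul x := by ext; simp

instance : Module Aᵐᵒᵖ (C.Form n) where
  one_smul x := by ext; simp
  mul_smul a b x := by ext; simp [mul_assoc]
  smul_zero a := by ext; simp
  smul_add a x y := by ext; simp [add_mul]
  add_smul a b x := by ext; simp [mul_add]
  zero_smul x := by ext; simp

instance : SMulCommClass A Aᵐᵒᵖ (C.Form n) where
  smul_comm a b x := by ext; simp [mul_assoc]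

end Form

open Form

/-- The differential `d : A → Ω^1`. -/
def dA : A →+ C.Form 1 where
  toFun a := of (C.d (C.incl a)) (C.d_mem (C.incl_mem a))
  map_zero' := by ext; simp
  map_add' a b := by ext; simp

@[simp] theorem val_dA (a : A) : val (C.dA a) = C.d (C.incl a) := rfl

/-- The differential `d : Ω^1 → Ω^2`. -/
def dOne : C.Form 1 →+ C.Form 2 where
  toFun x := of (C.d (val x)) (C.d_mem (val_mem x))
  map_zero' := by ext; simp
  map_add' a b := by ext; simp

@[simp] theorem val_dOne (x : C.Form 1) : val (C.dOne x) = C.d (val x) := rfl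

/-- The wedge product `Ω^1 × Ω^1 → Ω^2`; `C.wedge y` is `x ↦ x ∧ y`. -/
def wedge : C.Form 1 →+ (C.Form 1 →ₗ[A] C.Form 2) where
  toFun y :=
    { toFun := fun x => of (val x * val y) (C.mul_mem (val_mem x) (val_mem y))
      map_add' := fun x x' => by ext; simp [add_mul]
      map_smul' := fun a x => by ext; simp [mul_assoc] }
  map_zero' := by ext; simp
  map_add' y y' := by ext; simp [mul_add]

@[simp] theorem val_wedge (x y : C.Form 1) : val (C.wedge y x) = val x * val y := rfl

theorem d_incl_mul (a b : A) :
    C.d (C.incl (a * b)) = C.d (C.incl a) * C.incl b + C.incl a * C.d (C.incl b) := by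
  rw [map_mul, C.leibniz (C.incl_mem a)]; simp

theorem d_incl_mul_d (a b : A) :
    C.d (C.incl a * C.d (C.incl b)) = C.d (C.incl a) * C.d (C.incl b) := by
  rw [C.leibniz (C.incl_mem a), C.d_d]; simp

/-! ### The functors `E ↦ Ω^n ⊗_A E` and symmetric forms -/

section Forms

variable (E F : Type u) [AddCommGroup E] [Module A E] [AddCommGroup F] [Module A F]

/-- `Ω^n E = Ω^n ⊗_A E`. -/
abbrev FormT (n : ℕ) : Type u := BT A (C.Form n) E

variable {E F} in
/-- The functor `Ω^1` on morphisms. -/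
abbrev Om1 (g : E →ₗ[A] F) : C.FormT E 1 →ₗ[A] C.FormT F 1 := BT.map (C.Form 1) g

theorem wedge_op_smul (x y : C.Form 1) (a : A) :
    C.wedge (MulOpposite.op a • y) x = MulOpposite.op a • C.wedge y x := by
  ext; simp [mul_assoc]

theorem wedge_op_smul_left (x y : C.Form 1) (a : A) :
    C.wedge y (MulOpposite.op a • x) = C.wedge (a • y) x := by
  ext; simp [mul_assoc]

/-- `y ⊗ e ↦ (x ↦ (x ∧ y) ⊗ e)`. -/
def wedgeAux : C.FormT E 1 →+ (C.Form 1 →ₗ[A] C.FormT E 2) :=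
  BT.liftAdd
    { toFun := fun (y : C.Form 1) =>
        { toFun := fun (e : E) => (BT.mk (A := A) (M := C.Form 2) e).comp (C.wedge y)
          map_zero' := by ext x; simp
          map_add' := fun e e' => by ext x; simp }
      map_zero' := by ext e x; simp
      map_add' := fun y y' => by ext e x; simp [BT.add_tmul] }
    (fun y a e => by
      ext x
      simp [wedge_op_smul, BT.tmul_smul])

@[simp] theorem wedgeAux_tmul (x y : C.Form 1) (e : E) :
    C.wedgeAux E (BT.tmul A y e) x = BT.tmul A (C.wedge y x) e := rfl

/-- `∧ : Ω^1 ⊗_A (Ω^1 ⊗_A E) → Ω^2 ⊗_A E`. -/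
def wedgeT : C.FormT (C.FormT E 1) 1 →ₗ[A] C.FormT E 2 :=
  BT.lift (C.wedgeAux E)
    (fun x a z => by
      induction z using BT.induction with
      | h0 => simp
      | ht y e => rw [BT.smul_tmul', wedgeAux_tmul, wedgeAux_tmul, wedge_op_smul_left]
      | ha z z' h h' => simp only [smul_add, map_add, LinearMap.add_apply, h, h'])

@[simp] theorem wedgeT_tmul (x y : C.Form 1) (e : E) :
    C.wedgeT E (BT.tmul A x (BT.tmul A y e)) = BT.tmul A (C.wedge y x) e := rfl

end Forms

/-! ### 1-jets -/

section OneJets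

variable (E F G : Type u) [AddCommGroup E] [Module A E] [AddCommGroup F] [Module A F]
  [AddCommGroup G] [Module A G]

/-- Multiplication `A ⊗ A → A`. -/
def mulA : A ⊗[ℤ] A →ₗ[A] A := extend (AddMonoidHom.id A)

/-- `A ⊗ A → Ω^1`, `a ⊗ b ↦ a db`. -/
def symA : A ⊗[ℤ] A →ₗ[A] C.Form 1 := extend C.dA

/-- `N_d ⊆ A ⊗ A`: the elements `∑ aᵢ ⊗ bᵢ` with `∑ aᵢ bᵢ = 0` and `∑ aᵢ dbᵢ = 0`. -/
def Nd : Submodule A (A ⊗[ℤ] A) := LinearMap.ker (mulA (A := A)) ⊓ LinearMap.ker C.symA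

/-- `A ⊗ A → A ⊗ E`, `a ⊗ b ↦ a ⊗ b e`. -/
def actE {E : Type u} [AddCommGroup E] [Module A E] (e : E) : A ⊗[ℤ] A →ₗ[A] A ⊗[ℤ] E :=
  extend ((TensorProduct.mk ℤ A E 1).toAddMonoidHom.comp
    (LinearMap.toSpanSingleton A E e).toAddMonoidHom)

@[simp] theorem actE_tmul {E : Type u} [AddCommGroup E] [Module A E] (e : E) (a b : A) :
    actE e (a ⊗ₜ[ℤ] b) = a ⊗ₜ[ℤ] (b • e) := by
  simp [actE, TensorProduct.smul_tmul']

/-- `N_d E ⊆ A ⊗ E`, the span of the elements `∑ aᵢ ⊗ bᵢ e` with `∑ aᵢ ⊗ bᵢ ∈ N_d`. -/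
def NdE : Submodule A (A ⊗[ℤ] E) := ⨆ e : E, C.Nd.map (actE e)

/-- The 1-jet module `J^1 E = J^1 A ⊗_A E = (A ⊗ E) / N_d E`. Tensoring over `ℤ` or over `k`
gives the same quotient, because `c a ⊗ b - a ⊗ c b ∈ N_d` for `c ∈ k`. -/
def J1 : Type u := (A ⊗[ℤ] E) ⧸ C.NdE E

instance : AddCommGroup (C.J1 E) := Submodule.Quotient.addCommGroup (C.NdE E)
instance : Module A (C.J1 E) := Submodule.Quotient.module (C.NdE E)

/-- The quotient map `a ⊗ e ↦ [a ⊗ e]`. -/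
def J1mk : A ⊗[ℤ] E →ₗ[A] C.J1 E := (C.NdE E).mkQ

/-- The 1-jet prolongation `e ↦ [1 ⊗ e]`. -/
def j1 : E →+ C.J1 E := (C.J1mk E).toAddMonoidHom.comp (TensorProduct.mk ℤ A E 1).toAddMonoidHom

theorem J1mk_tmul (a : A) (e : E) : C.J1mk E (a ⊗ₜ[ℤ] e) = a • C.j1 E e := by
  change _ = a • C.J1mk E (1 ⊗ₜ[ℤ] e)
  rw [← map_smul, TensorProduct.smul_tmul', smul_eq_mul, mul_one]

variable {E F G}

theorem J1_induction {p : C.J1 E → Prop} (x : C.J1 E) (h0 : p 0)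
    (ht : ∀ (a : A) (e : E), p (a • C.j1 E e)) (ha : ∀ x y, p x → p y → p (x + y)) : p x := by
  obtain ⟨y, rfl⟩ := (C.NdE E).mkQ_surjective x
  induction y using TensorProduct.induction_on with
  | zero => rw [map_zero]; exact h0
  | tmul a e => exact (C.J1mk_tmul E a e) ▸ ht a e
  | add x y hx hy => rw [map_add]; exact ha _ _ hx hy

theorem J1mk_act (e : E) {x : A ⊗[ℤ] A} (hx : x ∈ C.Nd) : C.J1mk E (actE e x) = 0 :=
  (Submodule.Quotient.mk_eq_zero _).2
    (Submodule.mem_iSup_of_mem e (Submodule.mem_map_of_mem hx))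

theorem extend_actE (f : E →+ G) (e : E) (x : A ⊗[ℤ] A) :
    extend f (actE e x) =
      extend (A := A) (f.comp (LinearMap.toSpanSingleton A E e).toAddMonoidHom) x := by
  induction x using TensorProduct.induction_on with
  | zero => simp
  | tmul a b => simp
  | add x y hx hy => simp only [map_add, hx, hy]

/-- The `A`-linear lift `J^1 E → G`, `[a ⊗ e] ↦ a f(e)`, of an additive map `f : E → G` with
`∑ aᵢ f(bᵢ e) = 0` whenever `∑ aᵢ ⊗ bᵢ ∈ N_d`. -/
def J1lift (f : E →+ G) (hf : ∀ (e : E), ∀ x ∈ C.Nd,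
    extend (A := A) (f.comp (LinearMap.toSpanSingleton A E e).toAddMonoidHom) x = 0) :
    C.J1 E →ₗ[A] G :=
  (C.NdE E).liftQ (extend f) (by
    refine iSup_le fun e => ?_
    rintro _ ⟨x, hx, rfl⟩
    rw [LinearMap.mem_ker, extend_actE]
    exact hf e x hx)

@[simp] theorem J1lift_j1 (f : E →+ G) (hf) (e : E) : C.J1lift f hf (C.j1 E e) = f e := by
  change extend f (1 ⊗ₜ[ℤ] e) = f e
  simp

theorem extend_linear (f : A →ₗ[A] G) (x : A ⊗[ℤ] A) :
    extend (A := A) f.toAddMonoidHom x = f (mulA x) := by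
  induction x using TensorProduct.induction_on with
  | zero => simp
  | tmul a b =>
    change a • f b = f (a * b)
    rw [← smul_eq_mul, map_smul]
  | add x y hx hy => simp only [map_add, hx, hy]

variable (E) in
/-- The jet projection `π^{1,0}`, `[a ⊗ e] ↦ a e`. -/
def p1 : C.J1 E →ₗ[A] E :=
  C.J1lift (AddMonoidHom.id E) (fun e x hx => by
    have := extend_linear (LinearMap.toSpanSingleton A E e) x
    rw [show mulA x = 0 from hx.1, map_zero] at this
    exact this)

@[simp] theorem p1_j1 (e : E) : C.p1 E (C.j1 E e) = e := by simp [p1]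

theorem extend_j1 (e : E) (x : A ⊗[ℤ] A) :
    extend (A := A) ((C.j1 E).comp (LinearMap.toSpanSingleton A E e).toAddMonoidHom) x =
      C.J1mk E (actE e x) := by
  induction x using TensorProduct.induction_on with
  | zero => simp
  | tmul a b => simp [J1mk_tmul]
  | add x y hx hy => simp only [map_add, hx, hy]

/-- The functor `J^1` on morphisms, `[a ⊗ e] ↦ [a ⊗ g(e)]`. -/
def J1map (g : E →ₗ[A] F) : C.J1 E →ₗ[A] C.J1 F :=
  C.J1lift ((C.j1 F).comp g.toAddMonoidHom) (fun e x hx => by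
    have h : ((C.j1 F).comp g.toAddMonoidHom).comp
        (LinearMap.toSpanSingleton A E e).toAddMonoidHom =
        (C.j1 F).comp (LinearMap.toSpanSingleton A F (g e)).toAddMonoidHom := by
      ext b; simp
    rw [h, extend_j1, J1mk_act C _ hx])

@[simp] theorem J1map_j1 (g : E →ₗ[A] F) (e : E) :
    C.J1map g (C.j1 E e) = C.j1 F (g e) := by simp [J1map]

theorem symA_surjective : Function.Surjective C.symA := by
  intro ω
  have h : Form.val ω ∈ Submodule.span k {x | ∃ (a₀ : A) (a : Fin 1 → A),
      x = C.incl a₀ * (List.ofFn fun i => C.d (C.incl (a i))).prod} := by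
    rw [← C.surj 1]; exact Form.val_mem ω
  suffices H : ∃ x, Form.val (C.symA x) = Form.val ω by
    obtain ⟨x, hx⟩ := H
    exact ⟨x, Form.ext hx⟩
  generalize Form.val ω = z at h ⊢
  induction h using Submodule.span_induction with
  | mem x h =>
    obtain ⟨a₀, a, rfl⟩ := h
    exact ⟨a₀ ⊗ₜ a 0, by simp [symA]⟩
  | zero => exact ⟨0, by simp⟩
  | add x y _ _ hx hy =>
    obtain ⟨x', hx⟩ := hx
    obtain ⟨y', hy⟩ := hy
    exact ⟨x' + y', by rw [map_add, map_add, hx, hy]⟩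
  | smul c x _ hx =>
    obtain ⟨x', hx⟩ := hx
    exact ⟨algebraMap k A c • x', by rw [map_smul, Form.val_smul, hx]; simp [Algebra.smul_def]⟩

/-- `a ⊗ b ↦ [a ⊗ b e] - [a b ⊗ e]`. -/
def iotaPre : E →+ (A ⊗[ℤ] A →ₗ[A] C.J1 E) where
  toFun e := (C.J1mk E).comp (actE e) -
    (LinearMap.toSpanSingleton A (C.J1 E) (C.j1 E e)).comp mulA
  map_zero' := by
    apply LinearMap.ext; intro x
    induction x using TensorProduct.induction_on with
    | zero => simp
    | tmul a b => simp
    | add x y hx hy => simp only [map_add, hx, hy]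
  map_add' e e' := by
    apply LinearMap.ext; intro x
    induction x using TensorProduct.induction_on with
    | zero => simp
    | tmul a b => simp [J1mk_tmul]; abel
    | add x y hx hy => rw [map_add, hx, hy, map_add]

theorem iotaPre_tmul (e : E) (a b : A) :
    C.iotaPre e (a ⊗ₜ b) = a • C.j1 E (b • e) - (a * b) • C.j1 E e := by
  simp [iotaPre, J1mk_tmul, mulA]

theorem iotaPre_ker (e : E) : LinearMap.ker C.symA ≤ LinearMap.ker (C.iotaPre e) := by
  intro x hx
  have hx' : C.symA x = 0 := hx
  have hy : x - (mulA x) ⊗ₜ[ℤ] (1 : A) ∈ C.Nd := by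
    refine ⟨?_, ?_⟩
    · rw [SetLike.mem_coe, LinearMap.mem_ker, map_sub]
      simp [mulA]
    · have h1 : C.dA 1 = 0 := by
        have := C.d_incl_mul 1 1
        ext; simpa using this
      rw [SetLike.mem_coe, LinearMap.mem_ker, map_sub, hx']
      simp [symA, h1]
  have := C.J1mk_act e hy
  rw [LinearMap.mem_ker]
  rw [map_sub, map_sub, actE_tmul, J1mk_tmul, one_smul] at this
  exact this

/-- For `e : E`, the map `Ω^1 → J^1 E`, `a db ↦ [a ⊗ b e] - [a b ⊗ e]`. -/
def iotaAux (e : E) : C.Form 1 →ₗ[A] C.J1 E :=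
  ((LinearMap.ker C.symA).liftQ (C.iotaPre e) (C.iotaPre_ker e)).comp
    (C.symA.quotKerEquivOfSurjective C.symA_surjective).symm.toLinearMap

theorem iotaAux_symA (e : E) (x : A ⊗[ℤ] A) : C.iotaAux e (C.symA x) = C.iotaPre e x := by
  have : (C.symA.quotKerEquivOfSurjective C.symA_surjective).symm (C.symA x) =
      (LinearMap.ker C.symA).mkQ x := by
    rw [LinearEquiv.symm_apply_eq]; rfl
  simp [iotaAux, this]

variable (E) in
/-- The inclusion `ι^1 : Ω^1 ⊗_A E → J^1 E`, `a db ⊗ e ↦ [a ⊗ b e] - [a b ⊗ e]`. -/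
def iota1 : C.FormT E 1 →ₗ[A] C.J1 E :=
  BT.lift
    { toFun := C.iotaAux
      map_zero' := by
        ext ω
        obtain ⟨x, rfl⟩ := C.symA_surjective ω
        rw [iotaAux_symA, map_zero]; rfl
      map_add' := fun e e' => by
        ext ω
        obtain ⟨x, rfl⟩ := C.symA_surjective ω
        rw [LinearMap.add_apply, iotaAux_symA, iotaAux_symA, iotaAux_symA, map_add]; rfl }
    (fun ω c e => by
      obtain ⟨x, rfl⟩ := C.symA_surjective ω
      change C.iotaAux e _ = C.iotaAux (c • e) _
      induction x using TensorProduct.induction_on with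
      | zero => simp
      | tmul a b =>
        have h : MulOpposite.op c • C.symA (a ⊗ₜ b) =
            C.symA (a ⊗ₜ (b * c) - (a * b) ⊗ₜ c) := by
          ext
          simp [symA, C.d_incl_mul, -map_mul, map_mul C.incl a b, mul_add, mul_assoc]
        rw [h, iotaAux_symA, iotaAux_symA, map_sub, iotaPre_tmul, iotaPre_tmul, iotaPre_tmul]
        simp [mul_smul, mul_assoc]
      | add x y hx hy => simp only [map_add, smul_add, hx, hy])

@[simp] theorem iota1_tmul (a b : A) (e : E) :
    C.iota1 E (BT.tmul A (a • C.dA b) e) = a • C.j1 E (b • e) - (a * b) • C.j1 E e := by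
  rw [← iotaPre_tmul, ← iotaAux_symA]; rfl

theorem FormT_induction {p : C.FormT E 1 → Prop} (x : C.FormT E 1) (h0 : p 0)
    (ht : ∀ (a b : A) (e : E), p (BT.tmul A (a • C.dA b) e))
    (ha : ∀ x y, p x → p y → p (x + y)) : p x := by
  induction x using BT.induction with
  | h0 => exact h0
  | ht ω e =>
    obtain ⟨x, rfl⟩ := C.symA_surjective ω
    induction x using TensorProduct.induction_on with
    | zero => rw [map_zero, BT.zero_tmul]; exact h0
    | tmul a b => exact ht a b e
    | add x y hx hy => rw [map_add, BT.add_tmul]; exact ha _ _ hx hy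
  | ha x y hx hy => exact ha _ _ hx hy

end OneJets

/-! ### Holonomic jets and symmetric forms -/

section Holonomic

variable (E F : Type u) [AddCommGroup E] [Module A E] [AddCommGroup F] [Module A F]

/-- The underlying group of `(Ω^1 ⋉ Ω^2) E`, which is `Ω^1 E × Ω^2 E` with the left action
`a (α + β) = a α + da ∧ α + a β`. -/
def Semi : Type u := C.FormT E 1 × C.FormT E 2

instance : AddCommGroup (C.Semi E) :=
  Prod.instAddCommGroup (G := C.FormT E 1) (H := C.FormT E 2)

variable {E F}

theorem wedgeAux_smul (a : A) (z : C.FormT E 1) (x : C.Form 1) :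
    C.wedgeAux E (a • z) x = C.wedgeAux E z (MulOpposite.op a • x) := by
  induction z using BT.induction with
  | h0 => simp
  | ht y e => rw [BT.smul_tmul', wedgeAux_tmul, wedgeAux_tmul, wedge_op_smul_left]
  | ha z z' h h' => simp only [smul_add, map_add, LinearMap.add_apply, h, h']

theorem dA_mul (a b : A) : C.dA (a * b) = MulOpposite.op b • C.dA a + a • C.dA b := by
  ext; simp [-map_mul, d_incl_mul]

theorem dA_one : C.dA 1 = 0 := by
  have := C.dA_mul 1 1
  simpa using this

instance : Module A (C.Semi E) where
  smul a z := (a • z.1, C.wedgeAux E z.1 (C.dA a) + a • z.2)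
  one_smul z := by
    change ((1 : A) • z.1, C.wedgeAux E z.1 (C.dA 1) + (1 : A) • z.2) = z
    rw [dA_one, map_zero, one_smul, one_smul, zero_add]; rfl
  mul_smul a b z := by
    change ((a * b) • z.1, C.wedgeAux E z.1 (C.dA (a * b)) + (a * b) • z.2) =
      (a • b • z.1, C.wedgeAux E (b • z.1) (C.dA a) + a • (C.wedgeAux E z.1 (C.dA b) + b • z.2))
    rw [dA_mul, map_add, (C.wedgeAux E z.1).map_smul a (C.dA b), wedgeAux_smul, mul_smul, mul_smul,
      smul_add, add_assoc]
  smul_zero a := by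
    change (a • (0 : C.FormT E 1), C.wedgeAux E 0 (C.dA a) + a • (0 : C.FormT E 2)) = (0, 0)
    simp
  smul_add a z z' := by
    change (a • (z.1 + z'.1), C.wedgeAux E (z.1 + z'.1) (C.dA a) + a • (z.2 + z'.2)) =
      (a • z.1 + a • z'.1, C.wedgeAux E z.1 (C.dA a) + a • z.2 +
        (C.wedgeAux E z'.1 (C.dA a) + a • z'.2))
    rw [map_add, LinearMap.add_apply, smul_add, smul_add, add_add_add_comm]
  add_smul a b z := by
    change ((a + b) • z.1, C.wedgeAux E z.1 (C.dA (a + b)) + (a + b) • z.2) =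
      (a • z.1 + b • z.1, C.wedgeAux E z.1 (C.dA a) + a • z.2 +
        (C.wedgeAux E z.1 (C.dA b) + b • z.2))
    rw [map_add, map_add, add_smul, add_smul, add_add_add_comm]
  zero_smul z := by
    change ((0 : A) • z.1, C.wedgeAux E z.1 (C.dA 0) + (0 : A) • z.2) = (0, 0)
    simp

/-- The element `α + β` of `(Ω^1 ⋉ Ω^2) E`. -/
def Semi.mk (α : C.FormT E 1) (β : C.FormT E 2) : C.Semi E := (α, β)

theorem Semi.smul_mk (a : A) (α : C.FormT E 1) (β : C.FormT E 2) :
    a • Semi.mk C α β = Semi.mk C (a • α) (C.wedgeAux E α (C.dA a) + a • β) := rfl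

theorem Semi.mk_add (α α' : C.FormT E 1) (β β' : C.FormT E 2) :
    Semi.mk C α β + Semi.mk C α' β' = Semi.mk C (α + α') (β + β') := rfl

theorem Semi.mk_sub (α α' : C.FormT E 1) (β β' : C.FormT E 2) :
    Semi.mk C α β - Semi.mk C α' β' = Semi.mk C (α - α') (β - β') := rfl

theorem Semi.mk_zero : Semi.mk C (0 : C.FormT E 1) (0 : C.FormT E 2) = 0 := rfl

/-- `A ⊗ E → Ω^1 E`, `a ⊗ e ↦ da ⊗ e`. -/
def spencerPre : A ⊗[ℤ] E →+ C.FormT E 1 :=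
  TensorProduct.liftAddHom (R := ℤ)
    { toFun := fun a =>
        { toFun := fun e => BT.tmul A (C.dA a) e
          map_zero' := by rw [← BT.mk_apply, map_zero]; rfl
          map_add' := fun e e' => BT.tmul_add _ e e' }
      map_zero' := by ext e; simp [BT.zero_tmul]
      map_add' := fun a b => by ext e; simp [BT.add_tmul] }
    (fun r a e => by rw [map_zsmul, map_zsmul]; rfl)

@[simp] theorem spencerPre_tmul (a : A) (e : E) :
    C.spencerPre (a ⊗ₜ e) = BT.tmul A (C.dA a) e := rfl

theorem spencerPre_actE (e : E) (x : A ⊗[ℤ] A) :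
    C.spencerPre (actE e x) = BT.tmul A (C.dA (mulA x) - C.symA x) e := by
  induction x using TensorProduct.induction_on with
  | zero => simp [BT.zero_tmul]
  | tmul a b => simp [mulA, symA, dA_mul, BT.tmul_smul]
  | add x y hx hy =>
    rw [map_add, map_add, hx, hy, ← BT.add_tmul, map_add, map_add, map_add]
    congr 1; abel

variable (E) in
/-- The Spencer operator `J^1 E → Ω^1 E`, `[a ⊗ e] ↦ da ⊗ e`. -/
def spencer : C.J1 E →+ C.FormT E 1 :=
  QuotientAddGroup.lift (C.NdE E).toAddSubgroup C.spencerPre (by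
    intro x hx
    refine Submodule.iSup_induction (fun e : E => C.Nd.map (actE e)) (motive := fun x =>
      C.spencerPre x = 0) hx ?_ (map_zero _) (fun x y hx hy => by rw [map_add, hx, hy, add_zero])
    rintro e _ ⟨y, hy, rfl⟩
    rw [spencerPre_actE, show mulA y = 0 from hy.1, show C.symA y = 0 from hy.2]
    simp [BT.zero_tmul])

theorem spencer_smul_j1 (a : A) (e : E) :
    C.spencer E (a • C.j1 E e) = BT.tmul A (C.dA a) e := by
  rw [← J1mk_tmul]; rfl

theorem spencer_smul (b : A) (ξ : C.J1 E) :
    C.spencer E (b • ξ) = BT.tmul A (C.dA b) (C.p1 E ξ) + b • C.spencer E ξ := by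
  induction ξ using C.J1_induction with
  | h0 => rw [smul_zero, map_zero, map_zero, smul_zero, ← BT.mk_apply, map_zero]; simp
  | ht a e =>
    rw [smul_smul, spencer_smul_j1, spencer_smul_j1, map_smul, p1_j1, dA_mul, BT.add_tmul,
      BT.tmul_smul, BT.smul_tmul']
  | ha x y hx hy => rw [smul_add, map_add, hx, hy, map_add, map_add, BT.tmul_add, smul_add]; abel

/-- `ξ ↦ (da) ⊗ e + 0 ∈ (Ω^1 ⋉ Ω^2) E`, for `ξ = [a ⊗ e]`. -/
def spencerSemi : C.J1 E →+ C.Semi E where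
  toFun ξ := Semi.mk C (C.spencer E ξ) 0
  map_zero' := by rw [map_zero]; rfl
  map_add' ξ η := by rw [map_add, Semi.mk_add, add_zero]

theorem extend_spencerSemi (ξ : C.J1 E) (x : A ⊗[ℤ] A) :
    extend (A := A)
      (C.spencerSemi.comp (LinearMap.toSpanSingleton A (C.J1 E) ξ).toAddMonoidHom) x =
    Semi.mk C (BT.tmul A (C.symA x) (C.p1 E ξ) + mulA x • C.spencer E ξ)
      (BT.tmul A (C.dOne (C.symA x)) (C.p1 E ξ) +
        C.wedgeAux E (C.spencer E ξ) (C.dA (mulA x) - C.symA x)) := by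
  induction x using TensorProduct.induction_on with
  | zero => simp [BT.zero_tmul, Semi.mk_zero]
  | tmul a b =>
    have hd : C.dOne (a • C.dA b) = C.wedge (C.dA b) (C.dA a) := by
      ext; simp [d_incl_mul_d]
    have h1 : C.symA (a ⊗ₜ b) = a • C.dA b := rfl
    have h2 : mulA (a ⊗ₜ[ℤ] b) = a * b := rfl
    change a • Semi.mk C (C.spencer E (b • ξ)) 0 = _
    rw [Semi.smul_mk, spencer_smul, h1, h2, hd, dA_mul, add_sub_cancel_right, map_add,
      LinearMap.add_apply, wedgeAux_tmul, wedgeAux_smul, smul_add, BT.smul_tmul', mul_smul,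
      smul_zero, add_zero]
  | add x y hx hy =>
    rw [map_add, hx, hy, Semi.mk_add]
    congr 1
    · rw [map_add, BT.add_tmul, map_add, add_smul, add_add_add_comm]
    · rw [map_add, map_add, BT.add_tmul, map_add, map_add, add_sub_add_comm, map_add,
        add_add_add_comm]

variable (E) in
/-- The map `J^1 J^1 E → (Ω^1 ⋉ Ω^2) E`,
`[a ⊗ b] ⊗ [c ⊗ e] ↦ a d(b c) ⊗ e + da ∧ d(b c) ⊗ e`. -/
def DT : C.J1 (C.J1 E) →ₗ[A] C.Semi E :=
  C.J1lift C.spencerSemi (fun ξ x hx => by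
    rw [extend_spencerSemi, show mulA x = 0 from hx.1, show C.symA x = 0 from hx.2]
    simp [BT.zero_tmul, Semi.mk_zero])

theorem DT_j1 (ξ : C.J1 E) : C.DT E (C.j1 _ ξ) = Semi.mk C (C.spencer E ξ) 0 := by
  rw [DT, J1lift_j1]; rfl

/-- The defining formula of `DT` on generators. -/
theorem DT_apply (a b c : A) (e : E) :
    C.DT E (a • C.j1 _ (b • c • C.j1 E e)) =
      Semi.mk C (BT.tmul A (a • C.dA (b * c)) e)
        (BT.tmul A (C.wedge (C.dA (b * c)) (C.dA a)) e) := by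
  rw [(C.DT E).map_smul, DT_j1, smul_smul, spencer_smul_j1, Semi.smul_mk, BT.smul_tmul',
    wedgeAux_tmul, smul_zero, add_zero]

theorem p1_iota1 (z : C.FormT E 1) : C.p1 E (C.iota1 E z) = 0 := by
  induction z using C.FormT_induction with
  | h0 => simp
  | ht a b e => simp [mul_smul]
  | ha x y hx hy => rw [map_add, map_add, hx, hy, add_zero]

theorem spencer_iota1 (z : C.FormT E 1) : C.spencer E (C.iota1 E z) = -z := by
  induction z using C.FormT_induction with
  | h0 => simp
  | ht a b e =>
    rw [iota1_tmul, map_sub, spencer_smul_j1, spencer_smul_j1, BT.tmul_smul, dA_mul, BT.add_tmul]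
    abel
  | ha x y hx hy => rw [map_add, map_add, hx, hy, neg_add]

theorem DT_iota1 (z : C.FormT (C.FormT E 1) 1) :
    C.DT E (C.iota1 _ (C.Om1 (C.iota1 E) z)) = Semi.mk C 0 (C.wedgeT E z) := by
  induction z using C.FormT_induction with
  | h0 => simp [Semi.mk_zero]
  | ht a b α =>
    have h0 : BT.tmul A (C.dA b) (0 : E) = 0 := by rw [← BT.mk_apply, map_zero]; rfl
    have hw : C.wedgeT E (BT.tmul A (a • C.dA b) α) = C.wedgeAux E α (a • C.dA b) := rfl
    rw [BT.map_tmul, iota1_tmul, map_sub, (C.DT E).map_smul, (C.DT E).map_smul, DT_j1, DT_j1,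
      spencer_smul, p1_iota1, spencer_iota1, Semi.smul_mk, Semi.smul_mk, h0, hw, zero_add,
      Semi.mk_sub, dA_mul, smul_zero, smul_zero, add_zero, add_zero]
    congr 1
    · rw [smul_neg, smul_neg, smul_neg, smul_smul, sub_self]
    · rw [smul_neg, ← neg_smul, wedgeAux_smul, map_neg, map_add, LinearMap.neg_apply]
      simp
  | ha x y hx hy => rw [map_add, map_add, map_add, hx, hy, map_add, Semi.mk_add, add_zero]

theorem J1map_iota1 (g : E →ₗ[A] F) (z : C.FormT E 1) :
    C.J1map g (C.iota1 E z) = C.iota1 F (C.Om1 g z) := by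
  induction z using C.FormT_induction with
  | h0 => simp
  | ht a b e => simp
  | ha x y hx hy => simp only [map_add, hx, hy]

theorem wedgeT_map (g : E →ₗ[A] F) (z : C.FormT (C.FormT E 1) 1) :
    C.wedgeT F (C.Om1 (C.Om1 g) z) = BT.map (C.Form 2) g (C.wedgeT E z) := by
  induction z using BT.induction with
  | h0 => simp
  | ht x y =>
    induction y using BT.induction with
    | h0 => rw [← BT.mk_apply, map_zero]; simp
    | ht y e => simp
    | ha y y' h h' => rw [BT.tmul_add, map_add, map_add, h, h', map_add, map_add]
  | ha x y hx hy => simp only [map_add, hx, hy]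

theorem Om1_comp {G : Type u} [AddCommGroup G] [Module A G] (g : F →ₗ[A] G) (f : E →ₗ[A] F)
    (z : C.FormT E 1) : C.Om1 g (C.Om1 f z) = C.Om1 (g.comp f) z := by
  induction z using BT.induction with
  | h0 => simp
  | ht x y => simp
  | ha x y hx hy => simp only [map_add, hx, hy]

/-- The kernel of `J^1 E → J^1 J^1 F → (Ω^1 ⋉ Ω^2) F`, for a map `l : E → J^1 F`. -/
def jetKer (l : E →ₗ[A] C.J1 F) : Submodule A (C.J1 E) :=
  LinearMap.ker ((C.DT F).comp (C.J1map l))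

theorem mem_jetKer {l : E →ₗ[A] C.J1 F} {x : C.J1 E} :
    x ∈ C.jetKer l ↔ C.DT F (C.J1map l x) = 0 := Iff.rfl

/-- The kernel of `Ω^1 E → Ω^1 Ω^1 F → Ω^2 F`, for a map `i : E → Ω^1 F`. -/
def symKer (i : E →ₗ[A] C.FormT F 1) : Submodule A (C.FormT E 1) :=
  LinearMap.ker ((C.wedgeT F).comp (C.Om1 i))

theorem mem_symKer {i : E →ₗ[A] C.FormT F 1} {x : C.FormT E 1} :
    x ∈ C.symKer i ↔ C.wedgeT F (C.Om1 i x) = 0 := Iff.rfl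

variable (E)

/-- Pairs of left `A`-modules `P`, `Q` with a map `Q → J^1 P`. -/
abbrev JetPair : Type (u + 1) := Σ P : ModuleCat.{u} A, Σ Q : ModuleCat.{u} A, (Q →ₗ[A] C.J1 P)

/-- The modules `J^n E`, `J^{n+1} E` and the inclusion `J^{n+1} E → J^1 J^n E`. -/
def jetPair : ℕ → C.JetPair
  | 0 => ⟨ModuleCat.of A E, ModuleCat.of A (C.J1 E), LinearMap.id⟩
  | n + 1 => ⟨(jetPair n).2.1,
      ModuleCat.of A (C.jetKer (jetPair n).2.2), Submodule.subtype _⟩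

/-- The module of holonomic `n`-jets: `J^0 E = E`, `J^1 E` is the 1-jet module, and
`J^n E = ker (J^1 J^{n-1} E → J^1 J^1 J^{n-2} E → (Ω^1 ⋉ Ω^2) J^{n-2} E)`. -/
def Jet (n : ℕ) : Type u := (C.jetPair E n).1

instance (n : ℕ) : AddCommGroup (C.Jet E n) := (C.jetPair E n).1.isAddCommGroup
instance (n : ℕ) : Module A (C.Jet E n) := (C.jetPair E n).1.isModule

/-- The inclusion `l^{1,n} : J^{n+1} E → J^1 J^n E`. -/
def lJet (n : ℕ) : C.Jet E (n + 1) →ₗ[A] C.J1 (C.Jet E n) := (C.jetPair E n).2.2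

/-- The jet projection `π^{n+1,n}`. -/
def piJet (n : ℕ) : C.Jet E (n + 1) →ₗ[A] C.Jet E n := (C.p1 (C.Jet E n)).comp (C.lJet E n)

/-- An element of `J^{n+2} E` from an element of `J^1 J^{n+1} E` in the kernel. -/
def mkJet (n : ℕ) (x : C.J1 (C.Jet E (n + 1))) (hx : x ∈ C.jetKer (C.lJet E n)) :
    C.Jet E (n + 2) :=
  (⟨x, hx⟩ : C.jetKer (C.lJet E n))

@[simp] theorem lJet_mkJet (n : ℕ) (x : C.J1 (C.Jet E (n + 1)))
    (hx : x ∈ C.jetKer (C.lJet E n)) :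
    C.lJet E (n + 1) (C.mkJet E n x hx) = x := rfl

theorem lJet_injective (n : ℕ) : Function.Injective (C.lJet E n) := by
  cases n with
  | zero => exact Function.injective_id
  | succ n => exact Subtype.val_injective

theorem lJet_mem (n : ℕ) (x : C.Jet E (n + 2)) :
    C.lJet E (n + 1) x ∈ C.jetKer (C.lJet E n) :=
  Subtype.property (p := fun x => x ∈ C.jetKer (C.lJet E n)) x

/-- The prolongations `j^n`, `j^{n+1}`, with `l^{1,n} ∘ j^{n+1} = j^1 ∘ j^n`. -/
def jPair : (n : ℕ) → {p : (E →+ C.Jet E n) × (E →+ C.Jet E (n + 1)) //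
    ∀ e, C.lJet E n (p.2 e) = C.j1 (C.Jet E n) (p.1 e)}
  | 0 => ⟨(AddMonoidHom.id E, C.j1 E), fun _ => rfl⟩
  | n + 1 =>
    ⟨((jPair n).1.2,
      { toFun := fun e => C.mkJet E n (C.j1 _ ((jPair n).1.2 e)) (by
          rw [mem_jetKer, J1map_j1, (jPair n).2, DT_j1, ← one_smul A (C.j1 _ ((jPair n).1.1 e)),
            spencer_smul_j1, dA_one, BT.zero_tmul, Semi.mk_zero])
        map_zero' := C.lJet_injective E (n + 1) (by simp)
        map_add' := fun e e' => C.lJet_injective E (n + 1) (by simp) }), fun _ => rfl⟩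

/-- The jet prolongation `j^n : E → J^n E`. -/
def jJet (n : ℕ) : E →+ C.Jet E n := (C.jPair E n).1.1

theorem lJet_jJet (n : ℕ) (e : E) :
    C.lJet E n (C.jJet E (n + 1) e) = C.j1 (C.Jet E n) (C.jJet E n e) := (C.jPair E n).2 e

/-- Pairs of left `A`-modules `P`, `Q` with a map `Q → Ω^1 P`. -/
abbrev SymPair : Type (u + 1) :=
  Σ P : ModuleCat.{u} A, Σ Q : ModuleCat.{u} A, (Q →ₗ[A] C.FormT P 1)

/-- The modules `S^n E`, `S^{n+1} E` and the inclusion `S^{n+1} E → Ω^1 S^n E`. -/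
def symPair : ℕ → C.SymPair
  | 0 => ⟨ModuleCat.of A E, ModuleCat.of A (C.FormT E 1), LinearMap.id⟩
  | n + 1 => ⟨(symPair n).2.1,
      ModuleCat.of A (C.symKer (symPair n).2.2), Submodule.subtype _⟩

/-- Symmetric `n`-forms with values in `E`: `S^0 E = E`, `S^1 E = Ω^1 E`, and
`S^n E = ker (Ω^1 S^{n-1} E → Ω^1 Ω^1 S^{n-2} E → Ω^2 S^{n-2} E)`. -/
def Sym (n : ℕ) : Type u := (C.symPair E n).1

instance (n : ℕ) : AddCommGroup (C.Sym E n) := (C.symPair E n).1.isAddCommGroup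
instance (n : ℕ) : Module A (C.Sym E n) := (C.symPair E n).1.isModule

/-- The inclusion `ι_∧^{n+1} : S^{n+1} E → Ω^1 S^n E`. -/
def iotaW (n : ℕ) : C.Sym E (n + 1) →ₗ[A] C.FormT (C.Sym E n) 1 := (C.symPair E n).2.2

/-- An element of `S^{n+2} E` from an element of `Ω^1 S^{n+1} E` in the kernel. -/
def mkSym (n : ℕ) (x : C.FormT (C.Sym E (n + 1)) 1)
    (hx : x ∈ C.symKer (C.iotaW E n)) : C.Sym E (n + 2) :=
  (⟨x, hx⟩ : C.symKer (C.iotaW E n))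

@[simp] theorem iotaW_mkSym (n : ℕ) (x : C.FormT (C.Sym E (n + 1)) 1)
    (hx : x ∈ C.symKer (C.iotaW E n)) :
    C.iotaW E (n + 1) (C.mkSym E n x hx) = x := rfl

theorem iotaW_injective (n : ℕ) : Function.Injective (C.iotaW E n) := by
  cases n with
  | zero => exact Function.injective_id
  | succ n => exact Subtype.val_injective

/-- The map into `S^{n+2} E` induced by a map into the kernel. -/
def toSym {M : Type u} [AddCommGroup M] [Module A M] (n : ℕ)
    (f : M →ₗ[A] C.FormT (C.Sym E (n + 1)) 1)
    (hf : ∀ x, f x ∈ C.symKer (C.iotaW E n)) : M →ₗ[A] C.Sym E (n + 2) :=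
  { toFun := fun x => C.mkSym E n (f x) (hf x)
    map_add' := fun x y => C.iotaW_injective E (n + 1) (by simp)
    map_smul' := fun a x => C.iotaW_injective E (n + 1) (by simp) }

@[simp] theorem iotaW_toSym {M : Type u} [AddCommGroup M] [Module A M] (n : ℕ)
    (f : M →ₗ[A] C.FormT (C.Sym E (n + 1)) 1)
    (hf : ∀ x, f x ∈ C.symKer (C.iotaW E n)) (x : M) :
    C.iotaW E (n + 1) (C.toSym E n f hf x) = f x := rfl

theorem iotaW_mem (n : ℕ) (x : C.Sym E (n + 2)) :
    C.wedgeT (C.Sym E n) (C.Om1 (C.iotaW E n) (C.iotaW E (n + 1) x)) = 0 :=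
  Subtype.property (p := fun x => x ∈ C.symKer (C.iotaW E n)) x

/-- The map into `J^{n+2} E` induced by a map into the kernel. -/
def toJet {M : Type u} [AddCommGroup M] [Module A M] (n : ℕ)
    (f : M →ₗ[A] C.J1 (C.Jet E (n + 1)))
    (hf : ∀ x, f x ∈ C.jetKer (C.lJet E n)) : M →ₗ[A] C.Jet E (n + 2) :=
  { toFun := fun x => C.mkJet E n (f x) (hf x)
    map_add' := fun x y => C.lJet_injective E (n + 1) (by simp)
    map_smul' := fun a x => C.lJet_injective E (n + 1) (by simp) }

/-- The inclusions `ι^n`, `ι^{n+1}`, with `l^{1,n} ∘ ι^{n+1} = ι^1 ∘ Ω^1(ι^n) ∘ ι_∧^{n+1}`. -/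
def iotaPair : (n : ℕ) → {p : (C.Sym E n →ₗ[A] C.Jet E n) × (C.Sym E (n + 1) →ₗ[A] C.Jet E (n + 1))
    // ∀ x, C.lJet E n (p.2 x) = C.iota1 (C.Jet E n) (C.Om1 p.1 (C.iotaW E n x))}
  | 0 => ⟨(LinearMap.id, C.iota1 E), fun x => by
      have h : ∀ z : C.FormT E 1, C.Om1 (LinearMap.id : E →ₗ[A] E) z = z := fun z => by
        induction z using BT.induction with
        | h0 => simp
        | ht x y => simp
        | ha x y hx hy => rw [map_add, hx, hy]
      exact (congrArg (C.iota1 E) (h x)).symm⟩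
  | n + 1 =>
    ⟨((iotaPair n).1.2,
      C.toJet E n ((C.iota1 _).comp ((C.Om1 (iotaPair n).1.2).comp (C.iotaW E (n + 1)))) (by
        intro x
        have h : (C.lJet E n).comp (iotaPair n).1.2 =
            (C.iota1 (C.Jet E n)).comp ((C.Om1 (iotaPair n).1.1).comp (C.iotaW E n)) :=
          LinearMap.ext (iotaPair n).2
        rw [mem_jetKer, LinearMap.comp_apply, LinearMap.comp_apply, J1map_iota1, Om1_comp, h, ← Om1_comp,
          ← Om1_comp, DT_iota1, wedgeT_map, iotaW_mem, map_zero, Semi.mk_zero])), fun _ => rfl⟩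

/-- The inclusion `ι^n : S^n E → J^n E`. -/
def iotaJet (n : ℕ) : C.Sym E n →ₗ[A] C.Jet E n := (C.iotaPair E n).1.1

theorem lJet_iotaJet (n : ℕ) (x : C.Sym E (n + 1)) :
    C.lJet E n (C.iotaJet E (n + 1) x) =
      C.iota1 (C.Jet E n) (C.Om1 (C.iotaJet E n) (C.iotaW E n x)) := (C.iotaPair E n).2 x

variable {E}

/-- The maps `S^n(g)`, `S^{n+1}(g)`. -/
def symMapPair (g : E →ₗ[A] F) : (n : ℕ) →
    {p : (C.Sym E n →ₗ[A] C.Sym F n) × (C.Sym E (n + 1) →ₗ[A] C.Sym F (n + 1)) //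
      ∀ x, C.iotaW F n (p.2 x) = C.Om1 p.1 (C.iotaW E n x)}
  | 0 => ⟨(g, C.Om1 g), fun _ => rfl⟩
  | n + 1 =>
    ⟨((symMapPair g n).1.2,
      C.toSym F n ((C.Om1 (symMapPair g n).1.2).comp (C.iotaW E (n + 1))) (by
        intro x
        have h : (C.iotaW F n).comp (symMapPair g n).1.2 =
            (C.Om1 (symMapPair g n).1.1).comp (C.iotaW E n) :=
          LinearMap.ext (symMapPair g n).2
        rw [mem_symKer, LinearMap.comp_apply, Om1_comp, h, ← Om1_comp, wedgeT_map, iotaW_mem, map_zero])),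
      fun _ => rfl⟩

/-- The functor `S^n` on morphisms. -/
def symMap (g : E →ₗ[A] F) (n : ℕ) : C.Sym E n →ₗ[A] C.Sym F n := (C.symMapPair g n).1.1

theorem iotaW_symMap (g : E →ₗ[A] F) (n : ℕ) (x : C.Sym E (n + 1)) :
    C.iotaW F n (C.symMap g (n + 1) x) = C.Om1 (C.symMap g n) (C.iotaW E n x) :=
  (C.symMapPair g n).2 x

end Holonomic

/-! ### Connections -/

section Connections

/-- A left connection `∇ : E → Ω^1 E`; it is `k`-linear by the Leibniz rule, since `d` vanishes on
the image of `k`. -/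
structure LeftConnection (E : Type u) [AddCommGroup E] [Module A E] where
  nabla : E →+ C.FormT E 1
  leibniz : ∀ (a : A) (e : E), nabla (a • e) = a • nabla e + BT.tmul A (C.dA a) e

/-- Right multiplication by `a` on `Ω^1`. -/
def rmul (a : A) : C.Form 1 →ₗ[A] C.Form 1 where
  toFun ω := MulOpposite.op a • ω
  map_add' := smul_add _
  map_smul' b ω := (smul_comm b (MulOpposite.op a) ω).symm

@[simp] theorem rmul_apply (a : A) (ω : C.Form 1) : C.rmul a ω = MulOpposite.op a • ω := rfl

/-- A bimodule connection on `Ω^1`: a left connection `∇` together with a bimodule map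
`σ : Ω^1 ⊗_A Ω^1 → Ω^1 ⊗_A Ω^1` such that `∇(ω a) = ∇(ω) a + σ(ω ⊗ da)`. -/
structure BimoduleConnection extends C.LeftConnection (C.Form 1) where
  sigma : C.FormT (C.Form 1) 1 →ₗ[A] C.FormT (C.Form 1) 1
  sigma_right : ∀ (a : A) (x : C.FormT (C.Form 1) 1),
    sigma (C.Om1 (C.rmul a) x) = C.Om1 (C.rmul a) (sigma x)
  leibniz_right : ∀ (ω : C.Form 1) (a : A),
    nabla (MulOpposite.op a • ω) = C.Om1 (C.rmul a) (nabla ω) + sigma (BT.tmul A ω (C.dA a))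

variable {C} {F : Type u} [AddCommGroup F] [Module A F]

theorem mk_comp_rmul (a : A) (f : F) (x : C.FormT (C.Form 1) 1) :
    C.Om1 (BT.mk (A := A) (M := C.Form 1) f) (C.Om1 (C.rmul a) x) =
      C.Om1 (BT.mk (A := A) (M := C.Form 1) (a • f)) x := by
  rw [Om1_comp]
  congr 1
  congr 1
  ext ω
  simp [BT.tmul_smul]

theorem Om1_add {E : Type u} [AddCommGroup E] [Module A E] (g g' : E →ₗ[A] F)
    (x : C.FormT E 1) : C.Om1 (g + g') x = C.Om1 g x + C.Om1 g' x := by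
  induction x using BT.induction with
  | h0 => simp
  | ht ω e => simp [BT.tmul_add]
  | ha x y hx hy => rw [map_add, hx, hy, map_add, map_add, add_add_add_comm]

theorem Om1_zero {E : Type u} [AddCommGroup E] [Module A E]
    (x : C.FormT E 1) : C.Om1 (0 : E →ₗ[A] F) x = 0 := by
  have := Om1_add (C := C) (0 : E →ₗ[A] F) 0 x
  simpa using this

/-- `x ↦ (f ↦ x ⊗ f)`, for `x ∈ Ω^1 ⊗_A Ω^1`. -/
def tensF (F : Type u) [AddCommGroup F] [Module A F] :
    C.FormT (C.Form 1) 1 →+ F →+ C.FormT (C.FormT F 1) 1 where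
  toFun x :=
    { toFun := fun f => C.Om1 (BT.mk (A := A) (M := C.Form 1) f) x
      map_zero' := by rw [map_zero, Om1_zero]
      map_add' := fun f f' => by rw [map_add, Om1_add] }
  map_zero' := by ext f; simp
  map_add' x y := by ext f; simp

theorem tensF_apply (x : C.FormT (C.Form 1) 1) (f : F) :
    tensF F x f = C.Om1 (BT.mk (A := A) (M := C.Form 1) f) x := rfl

namespace BimoduleConnection

variable (D : C.BimoduleConnection)

/-- `η ⊗ f ↦ (ω ↦ σ(ω ⊗ η) ⊗ f)`. -/
def sigmaAux (F : Type u) [AddCommGroup F] [Module A F] :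
    C.FormT F 1 →+ (C.Form 1 →ₗ[A] C.FormT (C.FormT F 1) 1) :=
  BT.liftAdd
    { toFun := fun (η : C.Form 1) =>
        { toFun := fun (f : F) => (C.Om1 (BT.mk (A := A) (M := C.Form 1) f)).comp
            (D.sigma.comp (BT.mk (A := A) (M := C.Form 1) η))
          map_zero' := by ext ω; simp [Om1_zero]
          map_add' := fun f f' => by ext ω; simp [Om1_add] }
      map_zero' := by ext f ω; simp
      map_add' := fun η η' => by ext f ω; simp }
    (fun η a f => by
      ext ω
      change C.Om1 (BT.mk (A := A) f) (D.sigma (BT.tmul A ω (MulOpposite.op a • η))) =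
        C.Om1 (BT.mk (A := A) (a • f)) (D.sigma (BT.tmul A ω η))
      rw [← mk_comp_rmul, ← D.sigma_right]
      simp)

theorem sigmaAux_tmul (ω η : C.Form 1) (f : F) :
    D.sigmaAux F (BT.tmul A η f) ω = C.Om1 (BT.mk (A := A) f) (D.sigma (BT.tmul A ω η)) := rfl

theorem sigmaAux_smul (ω : C.Form 1) (a : A) (z : C.FormT F 1) :
    D.sigmaAux F z (MulOpposite.op a • ω) = D.sigmaAux F (a • z) ω := by
  induction z using BT.induction with
  | h0 => simp
  | ht η f => rw [BT.smul_tmul', sigmaAux_tmul, sigmaAux_tmul, BT.tmul_smul]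
  | ha x y hx hy => simp only [smul_add, map_add, LinearMap.add_apply, hx, hy]

/-- The map `σ ⊗_A id_F : Ω^1 Ω^1 F → Ω^1 Ω^1 F`. -/
def sigmaT (F : Type u) [AddCommGroup F] [Module A F] :
    C.FormT (C.FormT F 1) 1 →ₗ[A] C.FormT (C.FormT F 1) 1 :=
  BT.lift (D.sigmaAux F) (fun ω a z => D.sigmaAux_smul ω a z)

@[simp] theorem sigmaT_tmul (ω η : C.Form 1) (f : F) :
    D.sigmaT F (BT.tmul A ω (BT.tmul A η f)) =
      C.Om1 (BT.mk (A := A) f) (D.sigma (BT.tmul A ω η)) := rfl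

/-- `ω ↦ (f ↦ (σ ⊗ id_F)(ω ⊗ ∇(f)))`. -/
def sigmaNabla (N : C.LeftConnection F) : C.Form 1 →+ F →+ C.FormT (C.FormT F 1) 1 where
  toFun ω := (AddMonoidHom.flip (AddMonoidHom.mk' (fun z => (D.sigmaAux F z).toAddMonoidHom)
    (fun z z' => by ext x; simp)) ω).comp N.nabla
  map_zero' := by ext f; simp
  map_add' ω ω' := by ext f; simp

theorem sigmaNabla_apply (N : C.LeftConnection F) (ω : C.Form 1) (f : F) :
    D.sigmaNabla N ω f = D.sigmaT F (BT.tmul A ω (N.nabla f)) := rfl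

/-- The tensor product connection `Ω^1 F → Ω^1 Ω^1 F` of a bimodule connection on `Ω^1` and a left
connection on `F`, `ω ⊗ f ↦ ∇(ω) ⊗ f + (σ ⊗ id_F)(ω ⊗ ∇(f))`, as an additive map. -/
def tensorConn (N : C.LeftConnection F) : C.FormT F 1 →+ C.FormT (C.FormT F 1) 1 :=
  BT.liftAdd ((tensF F).comp D.nabla + D.sigmaNabla N) (fun ω a f => by
    simp only [AddMonoidHom.add_apply, AddMonoidHom.comp_apply, tensF_apply, sigmaNabla_apply,
      D.leibniz_right, N.leibniz, map_add, BT.tmul_add, mk_comp_rmul, sigmaT_tmul, BT.tmul_smul]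
    abel)

theorem tensorConn_tmul (N : C.LeftConnection F) (ω : C.Form 1) (f : F) :
    D.tensorConn N (BT.tmul A ω f) =
      C.Om1 (BT.mk (A := A) f) (D.nabla ω) + D.sigmaT F (BT.tmul A ω (N.nabla f)) := rfl

end BimoduleConnection

end Connections

/-! ### Retractions and iterated connections -/

section Iterated

variable (E : Type u) [AddCommGroup E] [Module A E]

/-- `s^n : Ω^1 S^n E → S^{n+1} E` is a retraction of the inclusion `ι_∧^{n+1}`, for all `n`. -/
def IsRetraction (s : ∀ n : ℕ, C.FormT (C.Sym E n) 1 →ₗ[A] C.Sym E (n + 1)) : Prop :=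
  ∀ (n : ℕ) (x : C.Sym E (n + 1)), s n (C.iotaW E n x) = x

variable {E}

/-- The operators `∇^n = s^{n-1} ∘ ∇^{S^{n-1} E} ∘ ⋯ ∘ s^0 ∘ ∇^E : E → S^n E`. -/
def iterNabla (s : ∀ n : ℕ, C.FormT (C.Sym E n) 1 →ₗ[A] C.Sym E (n + 1))
    (N : ∀ n : ℕ, C.LeftConnection (C.Sym E n)) : (n : ℕ) → E →+ C.Sym E n
  | 0 => AddMonoidHom.id E
  | n + 1 => (s n).toAddMonoidHom.comp ((N n).nabla.comp (iterNabla s N n))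

/-- `N` is the family of connections on the modules `S^n E` built from a bimodule connection `D`
on `Ω^1`, a left connection `N₀` on `E` and maps `s^n : Ω^1 S^n E → S^{n+1} E`: it starts with
`N₀`, and `∇^{S^{n+1} E} = Ω^1(s^n) ∘ ∇^{Ω^1 S^n E} ∘ ι_∧^{n+1}`. -/
def IsInducedConnection (D : C.BimoduleConnection) (N₀ : C.LeftConnection E)
    (s : ∀ n : ℕ, C.FormT (C.Sym E n) 1 →ₗ[A] C.Sym E (n + 1))
    (N : ∀ n : ℕ, C.LeftConnection (C.Sym E n)) : Prop :=
  N 0 = N₀ ∧ ∀ (n : ℕ) (x : C.Sym E (n + 1)),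
    (N (n + 1)).nabla x = C.Om1 (s n) (D.tensorConn (N n) (C.iotaW E n x))

end Iterated

/-! ### Differential operators, symbols and quantizations -/

section Quantization

variable (E : Type u) [AddCommGroup E] [Module A E]

/-- `J^n E` is elemental for all `n`: it is generated over `A` by the image of `j^n`. -/
def Elemental : Prop := ∀ n : ℕ, Submodule.span A (Set.range (C.jJet E n)) = ⊤

/-- The `n`-jet sequences `S^n E → J^n E → J^{n-1} E → 0` at `E` are exact, for all `n ≥ 1`. -/
def RightExact : Prop := ∀ n : ℕ,
  Function.Exact (C.iotaJet E (n + 1)) (C.piJet E n) ∧ Function.Surjective (C.piJet E n)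

variable (F G : Type u) [AddCommGroup F] [Module A F] [Module k F]
  [IsScalarTower k A F] [AddCommGroup G] [Module A G] [Module k G] [IsScalarTower k A G]

variable [Module k E]

/-- The linear differential operators `E → F` of order at most `n`: the maps which factor as
`Δ̃ ∘ j^n` for some left `A`-linear `Δ̃ : J^n E → F`. -/
def Diff (n : ℕ) : Submodule k (E →ₗ[k] F) where
  carrier := {Δ | ∃ L : C.Jet E n →ₗ[A] F, ∀ e, Δ e = L (C.jJet E n e)}
  zero_mem' := ⟨0, fun _ => rfl⟩
  add_mem' := by
    rintro Δ Δ' ⟨L, h⟩ ⟨L', h'⟩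
    exact ⟨L + L', fun e => by simp [h, h']⟩
  smul_mem' := by
    rintro c Δ ⟨L, h⟩
    refine ⟨
      { toFun := fun x => c • L x
        map_add' := fun x y => by rw [map_add, smul_add]
        map_smul' := fun a x => by
          rw [map_smul, RingHom.id_apply, ← algebraMap_smul A c (a • L x),
            ← algebraMap_smul A c (L x), smul_smul, smul_smul, Algebra.commutes] }, fun e => ?_⟩
    simp [h]

/-- The differential operators of order strictly less than `n`. -/
def DiffLT : ℕ → Submodule k (E →ₗ[k] F)
  | 0 => ⊥
  | n + 1 => C.Diff E F n

/-- All differential operators `E → F` of finite order. -/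
def DiffAll : Submodule k (E →ₗ[k] F) := ⨆ n, C.Diff E F n

/-- The symbols of order `n`, `Symb^n(E, F) = Diff^n(E, F) / Diff^{n-1}(E, F)`. -/
abbrev Symb (n : ℕ) : Type u := C.Diff E F n ⧸ (C.DiffLT E F n).submoduleOf (C.Diff E F n)

/-- The projection `ζ^n : Diff^n(E, F) → Symb^n(E, F)`. -/
def zeta (n : ℕ) : C.Diff E F n →ₗ[k] C.Symb E F n :=
  ((C.DiffLT E F n).submoduleOf (C.Diff E F n)).mkQ

variable {F G}

/-- A left `A`-linear map, seen as a `k`-linear map. -/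
def resK (φ : F →ₗ[A] G) : F →ₗ[k] G where
  toFun := φ
  map_add' := map_add φ
  map_smul' c x := by
    rw [RingHom.id_apply, ← algebraMap_smul A c x, map_smul, algebraMap_smul]

/-- `Diff^n(E, φ) : Δ ↦ φ ∘ Δ`. -/
def diffMap (φ : F →ₗ[A] G) (n : ℕ) : C.Diff E F n →ₗ[k] C.Diff E G n :=
  (LinearMap.llcomp k E F G (resK φ)).restrict (by
    rintro Δ ⟨L, h⟩
    exact ⟨φ.comp L, fun e => congrArg φ (h e)⟩)

theorem diffMap_apply (φ : F →ₗ[A] G) (n : ℕ) (Δ : C.Diff E F n) (e : E) :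
    (C.diffMap E φ n Δ : E →ₗ[k] G) e = φ ((Δ : E →ₗ[k] F) e) := rfl

/-- `Symb^n(E, φ) : [Δ] ↦ [φ ∘ Δ]`. -/
def symbMap (φ : F →ₗ[A] G) (n : ℕ) : C.Symb E F n →ₗ[k] C.Symb E G n :=
  Submodule.mapQ _ _ (C.diffMap E φ n) (by
    rintro Δ hΔ
    cases n with
    | zero =>
      have h : (Δ : E →ₗ[k] F) = 0 := hΔ
      change (C.diffMap E φ 0 Δ : E →ₗ[k] G) = 0
      ext e
      rw [diffMap_apply, h]; simp
    | succ n =>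
      obtain ⟨L, h⟩ := hΔ
      exact ⟨φ.comp L, fun e => congrArg φ (h e)⟩)

/-- A natural `n`-quantization for `E`: a natural section of `ζ^n : Diff^n(E, -) → Symb^n(E, -)`. -/
structure NaturalQuantization (n : ℕ) where
  app : ∀ (F : Type u) [AddCommGroup F] [Module A F] [Module k F] [IsScalarTower k A F],
    C.Symb E F n →ₗ[k] C.Diff E F n
  zeta_app : ∀ (F : Type u) [AddCommGroup F] [Module A F] [Module k F] [IsScalarTower k A F]
    (τ : C.Symb E F n), C.zeta E F n (app F τ) = τ
  naturality : ∀ (F G : Type u) [AddCommGroup F] [Module A F] [Module k F] [IsScalarTower k A F]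
    [AddCommGroup G] [Module A G] [Module k G] [IsScalarTower k A G] (φ : F →ₗ[A] G)
    (τ : C.Symb E F n), app G (C.symbMap E φ n τ) = C.diffMap E φ n (app F τ)

/-- A natural full quantization for `E`, given by a natural `n`-quantization for every `n`. -/
structure NaturalFullQuantization where
  component : ∀ n : ℕ, C.NaturalQuantization E n

/-- The map `q_F = ∑ q_F^n : ⨁ Symb^n(E, F) → Diff(E, F)`. -/
def NaturalFullQuantization.toLinearMap {C : ExteriorCalculus k A Ω} {E : Type u} [AddCommGroup E]
    [Module A E] [Module k E] (q : C.NaturalFullQuantization E)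
    (F : Type u) [AddCommGroup F] [Module A F] [Module k F] [IsScalarTower k A F] :
    (⨁ n : ℕ, C.Symb E F n) →ₗ[k] C.DiffAll E F :=
  DirectSum.toModule k ℕ (C.DiffAll E F)
    (fun n => (Submodule.inclusion (le_iSup (C.Diff E F) n)).comp ((q.component n).app F))

variable {E}

/-- `q` maps the symbol of every operator `Δ = L ∘ j^n`, with `L` left `A`-linear on `J^n E`, to
`L ∘ ι^n ∘ s^{n-1} ∘ ∇^{S^{n-1} E} ∘ ⋯ ∘ s^0 ∘ ∇^E`; here `L ∘ ι^n` is the restriction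
symbol of `Δ`. -/
def IsInducedQuantization
    (s : ∀ n : ℕ, C.FormT (C.Sym E n) 1 →ₗ[A] C.Sym E (n + 1))
    (N : ∀ n : ℕ, C.LeftConnection (C.Sym E n)) (q : C.NaturalFullQuantization E) : Prop :=
  ∀ (n : ℕ) (F : Type u) [AddCommGroup F] [Module A F] [Module k F] [IsScalarTower k A F]
    (Δ : C.Diff E F n) (L : C.Jet E n →ₗ[A] F), (∀ e, (Δ : E →ₗ[k] F) e = L (C.jJet E n e)) →
    ∀ e, (q.toLinearMap F (DirectSum.lof k ℕ (fun n => C.Symb E F n) n (C.zeta E F n Δ)) :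
      E →ₗ[k] F) e = L (C.iotaJet E n (C.iterNabla s N n e))

end Quantization

/-! ### Families of bimodule retractions -/

section Retractions

/-- `s^n : Ω^1 S^n A → S^{n+1} A` is right `A`-linear for all `n`; the right action of `a` on `S^n A`
is `S^n` of the left linear map `b ↦ b a`. -/
def IsRightLinear (s : ∀ n : ℕ, C.FormT (C.Sym A n) 1 →ₗ[A] C.Sym A (n + 1)) : Prop :=
  ∀ (n : ℕ) (a : A) (x : C.FormT (C.Sym A n) 1),
    s n (C.Om1 (C.symMap (LinearMap.toSpanSingleton A A a) n) x) =
      C.symMap (LinearMap.toSpanSingleton A A a) (n + 1) (s n x)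

variable (E : Type u) [AddCommGroup E] [Module A E]

/-- The canonical maps `S^n A ⊗_A E → S^n E` are surjective for all `n`. -/
def SymGenerated : Prop :=
  ∀ n : ℕ, ⨆ e : E, LinearMap.range (C.symMap (LinearMap.toSpanSingleton A E e) n) = ⊤

variable {E}

/-- `t^n : Ω^1 S^n E → S^{n+1} E` is the map `s^n ⊗_A id_E`, for all `n`. -/
def IsTensor (s : ∀ n : ℕ, C.FormT (C.Sym A n) 1 →ₗ[A] C.Sym A (n + 1))
    (t : ∀ n : ℕ, C.FormT (C.Sym E n) 1 →ₗ[A] C.Sym E (n + 1)) : Prop :=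
  ∀ (n : ℕ) (e : E) (x : C.FormT (C.Sym A n) 1),
    t n (C.Om1 (C.symMap (LinearMap.toSpanSingleton A E e) n) x) =
      C.symMap (LinearMap.toSpanSingleton A E e) (n + 1) (s n x)

end Retractions

end ExteriorCalculus

end NCJet

end

/-
A left connection on `E` is the same thing as a left linear retraction `J^1 E → Ω^1 E` of `ι^1`.
Hence connections on all `S^n E`, together with retractions `Ω^1 S^n E → S^{n+1} E`, compose to a
left linear retraction of `ι^n : S^n E → J^n E` which takes `j^n e` to `s ∘ ∇ ∘ ⋯ ∘ s ∘ ∇ (e)`.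
As the jet sequence is right exact, restriction along `ι^n` embeds the symbols of order `n` into
`Hom_A(S^n E, F)`, and composition with a retraction of `ι^n` is a natural section of it.

For the second part, bimodule retractions present `S^{n+1} A` as a retract of `Ω^1 S^n A`
compatibly with the right actions; since tensor products pass to retracts, induction on `n` shows
that `S^n E` is the tensor product `S^n A ⊗_A E` as soon as it is generated by the images of
`S^n A`.
-/

noncomputable section

namespace NCJet

section Tensor

variable {A : Type u} [Ring A]

section JointlySurjective

variable {ι M N G : Type*} [AddCommGroup M] [Module A M] [AddCommGroup N] [Module A N]

theorem addMonoidHom_ext_of_iSup_range_eq_top [AddZeroClass G] {μ : ι → M →ₗ[A] N}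
    (hμ : ⨆ i, LinearMap.range (μ i) = ⊤) {f g : N →+ G}
    (h : ∀ i m, f (μ i m) = g (μ i m)) : f = g := by
  ext n
  have hn : n ∈ ⨆ i, LinearMap.range (μ i) := hμ ▸ Submodule.mem_top
  induction hn using Submodule.iSup_induction' with
  | mem i _ hx => obtain ⟨m, rfl⟩ := hx; exact h i m
  | zero => rw [map_zero, map_zero]
  | add x y _ _ hx hy => rw [map_add, map_add, hx, hy]

theorem linearMap_ext_of_iSup_range_eq_top [AddCommGroup G] [Module A G] {μ : ι → M →ₗ[A] N}
    (hμ : ⨆ i, LinearMap.range (μ i) = ⊤) {f g : N →ₗ[A] G}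
    (h : ∀ i m, f (μ i m) = g (μ i m)) : f = g :=
  LinearMap.toAddMonoidHom_injective (addMonoidHom_ext_of_iSup_range_eq_top hμ h)

end JointlySurjective

section Exact

variable {M₁ M₂ M₃ N : Type*} [AddCommGroup M₁] [Module A M₁] [AddCommGroup M₂] [Module A M₂]
  [AddCommGroup M₃] [Module A M₃] [AddCommGroup N] [Module A N]

theorem exists_comp_eq_iff_comp_eq_zero {f : M₁ →ₗ[A] M₂} {g : M₂ →ₗ[A] M₃}
    (hfg : Function.Exact f g) (hg : Function.Surjective g) (h : M₂ →ₗ[A] N) :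
    (∃ l : M₃ →ₗ[A] N, l ∘ₗ g = h) ↔ h ∘ₗ f = 0 := by
  refine ⟨?_, fun hf => ?_⟩
  · rintro ⟨l, rfl⟩
    rw [LinearMap.comp_assoc, hfg.linearMap_comp_eq_zero, LinearMap.comp_zero]
  · refine ⟨((LinearMap.range f).liftQ h (LinearMap.range_le_ker_iff.2 hf)) ∘ₗ
      (hfg.linearEquivOfSurjective hg).symm.toLinearMap, ?_⟩
    ext x
    simp

end Exact

namespace BT

variable {P E F G : Type u} [AddCommGroup P] [Module A P] [Module Aᵐᵒᵖ P] [SMulCommClass A Aᵐᵒᵖ P]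
  [AddCommGroup E] [Module A E] [AddCommGroup F] [Module A F] [AddCommGroup G] [Module A G]

theorem linearMap_ext {f g : BT A P E →ₗ[A] G}
    (h : ∀ p e, f (tmul A p e) = g (tmul A p e)) : f = g := by
  ext x
  induction x using BT.induction with
  | h0 => rw [map_zero, map_zero]
  | ht p e => exact h p e
  | ha x y hx hy => rw [map_add, map_add, hx, hy]

theorem map_id : map P (LinearMap.id : E →ₗ[A] E) = LinearMap.id :=
  linearMap_ext fun _ _ => rfl

theorem map_comp (g : F →ₗ[A] G) (f : E →ₗ[A] F) : map P (g ∘ₗ f) = map P g ∘ₗ map P f :=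
  linearMap_ext fun _ _ => rfl

variable (P) in
/-- The functor `P ⊗_A -` on morphisms, as an additive map. -/
def mapHom : (E →ₗ[A] F) →+ (BT A P E →ₗ[A] BT A P F) :=
  AddMonoidHom.mk' (map P) fun g g' => linearMap_ext fun p e => tmul_add p (g e) (g' e)

@[simp] theorem mapHom_apply (g : E →ₗ[A] F) : mapHom P g = map P g := rfl

/-- Left multiplication `e ↦ p ⊗ e` by an element of `P`. -/
def tmulLeft (p : P) : E →+ BT A P E :=
  AddMonoidHom.mk' (tmul A p) (tmul_add p)

@[simp] theorem tmulLeft_apply (p : P) (e : E) : tmulLeft (A := A) p e = tmul A p e := rfl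

theorem iSup_range_map {ι : Type*} {μ : ι → E →ₗ[A] F} (hμ : ⨆ i, LinearMap.range (μ i) = ⊤) :
    ⨆ i, LinearMap.range (map P (μ i)) = ⊤ := by
  refine Submodule.eq_top_iff'.2 fun x => ?_
  induction x using BT.induction with
  | h0 => exact zero_mem _
  | ht p y =>
    have hy : y ∈ ⨆ i, LinearMap.range (μ i) := hμ ▸ Submodule.mem_top
    induction hy using Submodule.iSup_induction' with
    | mem i _ h =>
      obtain ⟨m, rfl⟩ := h
      exact Submodule.mem_iSup_of_mem i ⟨tmul A p m, map_tmul _ _ _⟩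
    | zero => rw [← tmulLeft_apply, map_zero]; exact zero_mem _
    | add y y' _ _ hy hy' => rw [tmul_add]; exact add_mem hy hy'
  | ha x y hx hy => exact add_mem hx hy

end BT

variable {M M' N N' E : Type u} [AddCommGroup M] [Module A M] [AddCommGroup M'] [Module A M']
  [AddCommGroup N] [Module A N] [AddCommGroup N'] [Module A N'] [AddCommGroup E] [Module A E]

/-- The pairing `(m, e) ↦ μ e m` exhibits `N` as the tensor product `M ⊗_A E`, where `a ∈ A` acts
from the right on `M` by the endomorphism `ρ a`: it is balanced, its values span `N`, and balanced
biadditive maps factor through it. -/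
structure IsBalancedTensor (ρ : A → M →ₗ[A] M) (μ : E →+ (M →ₗ[A] N)) : Prop where
  iSup_range_eq_top : ⨆ e, LinearMap.range (μ e) = ⊤
  map_smul : ∀ (a : A) (e : E), μ (a • e) = μ e ∘ₗ ρ a
  exists_lift : ∀ {G : Type u} [AddCommGroup G] (f : E →+ M →+ G),
    (∀ a e m, f (a • e) m = f e (ρ a m)) → ∃ g : N →+ G, ∀ e m, g (μ e m) = f e m

namespace IsBalancedTensor

variable {ρ : A → M →ₗ[A] M} {μ : E →+ (M →ₗ[A] N)}

theorem exists_linearLift (h : IsBalancedTensor ρ μ) {G : Type u} [AddCommGroup G] [Module A G]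
    (f : E →+ (M →ₗ[A] G)) (hf : ∀ a e, f (a • e) = f e ∘ₗ ρ a) :
    ∃ g : N →ₗ[A] G, ∀ e, g ∘ₗ μ e = f e := by
  obtain ⟨g, hg⟩ := h.exists_lift (LinearMap.toAddMonoidHom'.comp f) fun a e m =>
    LinearMap.congr_fun (hf a e) m
  replace hg : ∀ e m, g (μ e m) = f e m := hg
  have g_smul (a : A) : g.comp (DistribSMul.toAddMonoidHom N a) =
      (DistribSMul.toAddMonoidHom G a).comp g :=
    addMonoidHom_ext_of_iSup_range_eq_top h.iSup_range_eq_top fun e m => by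
      simp only [AddMonoidHom.comp_apply, DistribSMul.toAddMonoidHom_apply]
      rw [← LinearMap.map_smul, hg, hg, LinearMap.map_smul]
  exact ⟨{ g with map_smul' := fun a => DFunLike.congr_fun (g_smul a) },
    fun e => LinearMap.ext (hg e)⟩

variable (A E) in
theorem toSpanSingleton : IsBalancedTensor (LinearMap.toSpanSingleton A A)
    (AddMonoidHom.mk' (LinearMap.toSpanSingleton A E) fun e e' =>
      LinearMap.ext fun a => smul_add a e e') where
  iSup_range_eq_top := eq_top_iff.2 fun e _ => Submodule.mem_iSup_of_mem e ⟨1, one_smul A e⟩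
  map_smul a e := LinearMap.ext fun b => (mul_smul b a e).symm
  exists_lift f hf := ⟨f.flip 1, fun e a => by
    simpa using hf a e 1⟩

theorem map (h : IsBalancedTensor ρ μ) (P : Type u) [AddCommGroup P] [Module A P] [Module Aᵐᵒᵖ P]
    [SMulCommClass A Aᵐᵒᵖ P] :
    IsBalancedTensor (fun a => BT.map P (ρ a)) ((BT.mapHom P).comp μ) where
  iSup_range_eq_top := BT.iSup_range_map h.iSup_range_eq_top
  map_smul a e := by
    simp only [AddMonoidHom.comp_apply, BT.mapHom_apply, h.map_smul, BT.map_comp]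
  exists_lift {G} _ f hf := by
    choose g hg using fun p : P => h.exists_lift
      ((AddMonoidHom.compHom.flip (BT.tmulLeft p)).comp f) fun a e m => hf a e (BT.tmul A p m)
    replace hg : ∀ p e m, g p (μ e m) = f e (BT.tmul A p m) := hg
    have ext_g {φ ψ : N →+ G} : (∀ e m, φ (μ e m) = ψ (μ e m)) → φ = ψ :=
      addMonoidHom_ext_of_iSup_range_eq_top h.iSup_range_eq_top
    have g_add (p p' : P) : g (p + p') = g p + g p' := ext_g fun e m => by
      rw [AddMonoidHom.add_apply, hg, hg, hg, BT.add_tmul, map_add]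
    have g_smul (p : P) (a : A) (n : N) : g (MulOpposite.op a • p) n = g p (a • n) := by
      refine DFunLike.congr_fun (ext_g (ψ := (g p).comp (DistribSMul.toAddMonoidHom N a))
        fun e m => ?_) n
      rw [AddMonoidHom.comp_apply, DistribSMul.toAddMonoidHom_apply, ← LinearMap.map_smul, hg, hg,
        BT.tmul_smul]
    refine ⟨BT.liftAdd (A := A) (AddMonoidHom.mk' g g_add) g_smul, fun e x => ?_⟩
    induction x using BT.induction with
    | h0 => simp only [map_zero]
    | ht p m => exact hg p e m
    | ha x y hx hy => rw [map_add, map_add, map_add, hx, hy]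

theorem of_retract (h : IsBalancedTensor ρ μ) {ρ' : A → M' →ₗ[A] M'} {μ' : E →+ (M' →ₗ[A] N')}
    (hμ' : ⨆ e, LinearMap.range (μ' e) = ⊤) (map_smul : ∀ a e, μ' (a • e) = μ' e ∘ₗ ρ' a)
    (i : M' →ₗ[A] M) (s : M →ₗ[A] M') (hsi : s ∘ₗ i = LinearMap.id)
    (hs : ∀ a, s ∘ₗ ρ a = ρ' a ∘ₗ s) (j : N' →ₗ[A] N) (hj : ∀ e, j ∘ₗ μ' e = μ e ∘ₗ i) :
    IsBalancedTensor ρ' μ' where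
  iSup_range_eq_top := hμ'
  map_smul := map_smul
  exists_lift f hf := by
    obtain ⟨g, hg⟩ := h.exists_lift ((AddMonoidHom.compHom.flip s.toAddMonoidHom).comp f)
      fun a e m => (hf a e (s m)).trans (congrArg (f e) (LinearMap.congr_fun (hs a) m).symm)
    refine ⟨g.comp j.toAddMonoidHom, fun e m => ?_⟩
    calc g (j (μ' e m)) = g (μ e (i m)) := congrArg g (LinearMap.congr_fun (hj e) m)
      _ = f e (s (i m)) := hg e (i m)
      _ = f e m := congrArg (f e) (LinearMap.congr_fun hsi m)

end IsBalancedTensor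

end Tensor

namespace ExteriorCalculus

variable {k : Type w} {A Ω : Type u} [CommRing k] [Ring A] [Algebra k A] [Ring Ω] [Algebra k Ω]
  {C : ExteriorCalculus k A Ω}

section Sym

section Functoriality

variable {E F G : Type u} [AddCommGroup E] [Module A E] [AddCommGroup F] [Module A F]
  [AddCommGroup G] [Module A G]

theorem symMap_comp (g : F →ₗ[A] G) (f : E →ₗ[A] F) (n : ℕ) :
    C.symMap (g ∘ₗ f) n = C.symMap g n ∘ₗ C.symMap f n := by
  induction n with
  | zero => rfl
  | succ n ih =>
    ext x
    apply C.iotaW_injective G n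
    rw [iotaW_symMap, ih, LinearMap.comp_apply, iotaW_symMap, iotaW_symMap, Om1_comp]

theorem symMap_add (f g : E →ₗ[A] F) (n : ℕ) :
    C.symMap (f + g) n = C.symMap f n + C.symMap g n := by
  induction n with
  | zero => rfl
  | succ n ih =>
    ext x
    apply C.iotaW_injective F n
    rw [iotaW_symMap, ih, LinearMap.add_apply, map_add, iotaW_symMap, iotaW_symMap, Om1_add]

end Functoriality

variable {E : Type u} [AddCommGroup E] [Module A E]

variable (C E) in
/-- The canonical pairing of `S^n A` and `E` with values in `S^n E`: it takes `e` to the map induced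
by `a ↦ a e`. -/
def symPairing (n : ℕ) : E →+ (C.Sym A n →ₗ[A] C.Sym E n) :=
  AddMonoidHom.mk' (fun e => C.symMap (LinearMap.toSpanSingleton A E e) n) fun e e' => by
    rw [← symMap_add, LinearMap.toSpanSingleton_add]

theorem symPairing_smul (n : ℕ) (a : A) (e : E) :
    C.symPairing E n (a • e) = C.symPairing E n e ∘ₗ C.symPairing A n a := by
  refine Eq.trans ?_ (symMap_comp _ _ n)
  exact congrArg (C.symMap · n) (LinearMap.ext fun b => (mul_smul b a e).symm)

variable {s : ∀ n : ℕ, C.FormT (C.Sym A n) 1 →ₗ[A] C.Sym A (n + 1)}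
  {t t' : ∀ n : ℕ, C.FormT (C.Sym E n) 1 →ₗ[A] C.Sym E (n + 1)}

theorem IsRetraction.isBalancedTensor_symPairing (hs : C.IsRetraction A s)
    (hr : C.IsRightLinear s) (hgen : C.SymGenerated E) (n : ℕ) :
    IsBalancedTensor (C.symPairing A n) (C.symPairing E n) := by
  induction n with
  | zero => exact IsBalancedTensor.toSpanSingleton A E
  | succ n ih =>
    exact (ih.map (C.Form 1)).of_retract (hgen (n + 1)) (symPairing_smul (n + 1))
      (C.iotaW A n) (s n) (LinearMap.ext (hs n)) (fun a => LinearMap.ext (hr n a))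
      (C.iotaW E n) (fun e => LinearMap.ext (C.iotaW_symMap (LinearMap.toSpanSingleton A E e) n))

theorem IsRetraction.exists_isTensor (hs : C.IsRetraction A s) (hr : C.IsRightLinear s)
    (hgen : C.SymGenerated E) :
    ∃ t : ∀ n : ℕ, C.FormT (C.Sym E n) 1 →ₗ[A] C.Sym E (n + 1), C.IsTensor s t := by
  choose t ht using fun n =>
    ((hs.isBalancedTensor_symPairing hr hgen n).map (C.Form 1)).exists_linearLift
      ((LinearMap.lcomp ℤ _ (s n)).toAddMonoidHom.comp (C.symPairing E (n + 1))) fun a e => by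
        ext x
        calc C.symPairing E (n + 1) (a • e) (s n x)
            = C.symPairing E (n + 1) e (C.symPairing A (n + 1) a (s n x)) :=
              LinearMap.congr_fun (symPairing_smul (n + 1) a e) (s n x)
          _ = C.symPairing E (n + 1) e (s n (C.Om1 (C.symPairing A n a) x)) :=
              congrArg (C.symPairing E (n + 1) e) (hr n a x).symm
  exact ⟨t, fun n e x => LinearMap.congr_fun (ht n e) x⟩

theorem IsTensor.eq (hgen : C.SymGenerated E) (ht : C.IsTensor s t) (ht' : C.IsTensor s t') :
    t = t' :=
  funext fun n => linearMap_ext_of_iSup_range_eq_top (BT.iSup_range_map (hgen n)) fun e x =>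
    (ht n e x).trans (ht' n e x).symm

theorem IsTensor.isRetraction (ht : C.IsTensor s t) (hs : C.IsRetraction A s)
    (hgen : C.SymGenerated E) : C.IsRetraction E t := by
  intro n
  refine LinearMap.congr_fun (f := t n ∘ₗ C.iotaW E n) (g := LinearMap.id)
    (linearMap_ext_of_iSup_range_eq_top (hgen (n + 1)) fun e y => ?_)
  rw [LinearMap.comp_apply, iotaW_symMap, ht, hs, LinearMap.id_apply]

end Sym

section Connections

variable {E F : Type u} [AddCommGroup E] [Module A E] [AddCommGroup F] [Module A F]

namespace LeftConnection

variable (N : C.LeftConnection E)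

theorem extend_nabla (e : E) (x : A ⊗[ℤ] A) :
    extend (A := A) (N.nabla.comp (LinearMap.toSpanSingleton A E e).toAddMonoidHom) x =
      mulA x • N.nabla e + BT.tmul A (C.symA x) e := by
  induction x using TensorProduct.induction_on with
  | zero => simp [BT.zero_tmul]
  | tmul a b =>
    change a • N.nabla (b • e) = (a * b) • N.nabla e + BT.tmul A (a • C.dA b) e
    rw [N.leibniz, smul_add, mul_smul, BT.smul_tmul']
  | add x y hx hy =>
    rw [map_add, hx, hy, map_add, map_add, add_smul, BT.add_tmul, add_add_add_comm]

/-- The left linear map `J^1 E → Ω^1 E`, `[a ⊗ e] ↦ a ∇ e`, corresponding to a left connection. -/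
def jetLift : C.J1 E →ₗ[A] C.FormT E 1 :=
  C.J1lift N.nabla fun e x hx => by
    rw [extend_nabla, show mulA x = 0 from hx.1, show C.symA x = 0 from hx.2, zero_smul,
      BT.zero_tmul, add_zero]

@[simp] theorem jetLift_j1 (e : E) : N.jetLift (C.j1 E e) = N.nabla e := J1lift_j1 _ _ _ _

theorem jetLift_iota1 (z : C.FormT E 1) : N.jetLift (C.iota1 E z) = z := by
  induction z using C.FormT_induction with
  | h0 => rw [map_zero, map_zero]
  | ht a b e =>
    rw [iota1_tmul, map_sub, LinearMap.map_smul, LinearMap.map_smul, jetLift_j1, jetLift_j1,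
      N.leibniz, smul_add, mul_smul, BT.smul_tmul', add_sub_cancel_left]
  | ha x y hx hy => rw [map_add, map_add, hx, hy]

/-- The left connection `Ω^1(s) ∘ ∇ ∘ i` on a retract `i : F → E` of a module with a left
connection. -/
def ofRetract (i : F →ₗ[A] E) (s : E →ₗ[A] F) (hsi : Function.LeftInverse s i) :
    C.LeftConnection F where
  nabla := (C.Om1 s).toAddMonoidHom.comp (N.nabla.comp i.toAddMonoidHom)
  leibniz a x := by
    change C.Om1 s (N.nabla (i (a • x))) = a • C.Om1 s (N.nabla (i x)) + _
    rw [map_smul, N.leibniz, map_add, map_smul, BT.map_tmul, hsi]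

end LeftConnection

/-- The left connection on `Ω^1 E` whose underlying additive map is `tensorConn`. -/
def BimoduleConnection.tensorConnection (D : C.BimoduleConnection) (N : C.LeftConnection E) :
    C.LeftConnection (C.FormT E 1) where
  nabla := D.tensorConn N
  leibniz a z := by
    induction z using BT.induction with
    | h0 => rw [smul_zero, map_zero, smul_zero, ← BT.tmulLeft_apply, map_zero, zero_add]
    | ht ω e =>
      rw [BT.smul_tmul', tensorConn_tmul, tensorConn_tmul, D.leibniz, map_add, map_smul,
        ← BT.smul_tmul', map_smul, BT.map_tmul, BT.mk_apply, smul_add]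
      abel
    | ha x y hx hy => rw [smul_add, map_add, hx, hy, map_add, smul_add, BT.tmul_add]; abel

variable {t : ∀ n : ℕ, C.FormT (C.Sym E n) 1 →ₗ[A] C.Sym E (n + 1)}

/-- The left connections on all `S^n E` built from a left connection on `E` and retractions of
`ι_∧`. -/
def symConnection (D : C.BimoduleConnection) (N₀ : C.LeftConnection E) (ht : C.IsRetraction E t) :
    ∀ n : ℕ, C.LeftConnection (C.Sym E n)
  | 0 => N₀
  | n + 1 => (D.tensorConnection (symConnection D N₀ ht n)).ofRetract (C.iotaW E n) (t n) (ht n)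

theorem isInducedConnection_symConnection (D : C.BimoduleConnection) (N₀ : C.LeftConnection E)
    (ht : C.IsRetraction E t) : C.IsInducedConnection D N₀ t (symConnection D N₀ ht) :=
  ⟨rfl, fun _ _ => rfl⟩

end Connections

section Splitting

variable {E : Type u} [AddCommGroup E] [Module A E]
  (t : ∀ n : ℕ, C.FormT (C.Sym E n) 1 →ₗ[A] C.Sym E (n + 1))
  (N : ∀ n : ℕ, C.LeftConnection (C.Sym E n))

/-- The left linear map `J^n E → S^n E` which corresponds to the operator `iterNabla`. -/
def iterJetLift : (n : ℕ) → C.Jet E n →ₗ[A] C.Sym E n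
  | 0 => (LinearMap.id : E →ₗ[A] E)
  | n + 1 => t n ∘ₗ (N n).jetLift ∘ₗ C.J1map (iterJetLift n) ∘ₗ C.lJet E n

theorem iterJetLift_succ (n : ℕ) (x : C.Jet E (n + 1)) :
    iterJetLift t N (n + 1) x = t n ((N n).jetLift (C.J1map (iterJetLift t N n) (C.lJet E n x))) :=
  rfl

theorem iterJetLift_jJet (n : ℕ) (e : E) :
    iterJetLift t N n (C.jJet E n e) = C.iterNabla t N n e := by
  induction n with
  | zero => rfl
  | succ n ih => rw [iterJetLift_succ, lJet_jJet, J1map_j1, ih, LeftConnection.jetLift_j1]; rfl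

variable {t} in
theorem IsRetraction.iterJetLift_comp_iotaJet (ht : C.IsRetraction E t) (n : ℕ) :
    iterJetLift t N n ∘ₗ C.iotaJet E n = LinearMap.id := by
  induction n with
  | zero => rfl
  | succ n ih =>
    ext x
    rw [LinearMap.comp_apply, iterJetLift_succ, lJet_iotaJet, J1map_iota1,
      LeftConnection.jetLift_iota1, Om1_comp, ih,
      show C.Om1 LinearMap.id = LinearMap.id from BT.map_id, LinearMap.id_apply, ht,
      LinearMap.id_apply]

end Splitting

section Operators

theorem dA_algebraMap (c : k) : C.dA (algebraMap k A c) = 0 := by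
  have h1 : C.d 1 = 0 := by simpa using congrArg Form.val C.dA_one
  ext
  simp [Algebra.algebraMap_eq_smul_one, h1]

section

variable {E : Type u} [AddCommGroup E] [Module A E]

theorem j1_algebraMap_smul (c : k) (e : E) :
    C.j1 E (algebraMap k A c • e) = algebraMap k A c • C.j1 E e := by
  have h := C.iota1_tmul 1 (algebraMap k A c) e
  rw [dA_algebraMap, smul_zero, BT.zero_tmul, map_zero, one_smul, one_mul] at h
  exact sub_eq_zero.1 h.symm

theorem jJet_algebraMap_smul (n : ℕ) (c : k) (e : E) :
    C.jJet E n (algebraMap k A c • e) = algebraMap k A c • C.jJet E n e := by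
  induction n with
  | zero => rfl
  | succ n ih =>
    apply C.lJet_injective E n
    rw [lJet_jJet, ih, (C.lJet E n).map_smul, lJet_jJet, j1_algebraMap_smul]

theorem piJet_jJet (n : ℕ) (e : E) : C.piJet E n (C.jJet E (n + 1) e) = C.jJet E n e := by
  rw [piJet, LinearMap.comp_apply, lJet_jJet, p1_j1]

theorem Elemental.ext {F : Type*} [AddCommGroup F] [Module A F] (hel : C.Elemental E) {n : ℕ}
    {L L' : C.Jet E n →ₗ[A] F} (h : ∀ e, L (C.jJet E n e) = L' (C.jJet E n e)) : L = L' :=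
  LinearMap.ext_on_range (hel n) h

end

variable {E F G : Type u} [AddCommGroup E] [Module A E] [Module k E] [IsScalarTower k A E]
  [AddCommGroup F] [Module A F] [Module k F] [IsScalarTower k A F]
  [AddCommGroup G] [Module A G] [Module k G] [IsScalarTower k A G]

variable (C E F) in
/-- The surjection `L ↦ L ∘ j^n` of `Hom_A(J^n E, F)` onto the operators of order at most `n`. -/
def diffOfJet (n : ℕ) : (C.Jet E n →ₗ[A] F) →ₗ[k] C.Diff E F n where
  toFun L :=
    ⟨{ toFun := fun e => L (C.jJet E n e)
       map_add' := fun e e' => by rw [map_add, map_add]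
       map_smul' := fun c e => by
        rw [← algebraMap_smul A c e, jJet_algebraMap_smul, map_smul, algebraMap_smul,
          RingHom.id_apply] }, L, fun _ => rfl⟩
  map_add' _ _ := rfl
  map_smul' _ _ := rfl

theorem diffOfJet_apply (n : ℕ) (L : C.Jet E n →ₗ[A] F) (e : E) :
    (C.diffOfJet E F n L : E →ₗ[k] F) e = L (C.jJet E n e) := rfl

theorem diffOfJet_eq {n : ℕ} {Δ : C.Diff E F n} {L : C.Jet E n →ₗ[A] F}
    (h : ∀ e, (Δ : E →ₗ[k] F) e = L (C.jJet E n e)) : C.diffOfJet E F n L = Δ :=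
  Subtype.ext (LinearMap.ext fun e => (h e).symm)

theorem diffOfJet_surjective (n : ℕ) : Function.Surjective (C.diffOfJet E F n) := fun Δ =>
  let ⟨L, hL⟩ := Δ.2
  ⟨L, diffOfJet_eq hL⟩

theorem diffMap_diffOfJet (φ : F →ₗ[A] G) (n : ℕ) (L : C.Jet E n →ₗ[A] F) :
    C.diffMap E φ n (C.diffOfJet E F n L) = C.diffOfJet E G n (φ ∘ₗ L) := rfl

theorem Elemental.diffOfJet_injective (hel : C.Elemental E) (n : ℕ) :
    Function.Injective (C.diffOfJet E F n) := fun _ _ h =>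
  hel.ext fun e => LinearMap.congr_fun (congrArg Subtype.val h) e

theorem Elemental.diffOfJet_mem_diffLT_iff (hel : C.Elemental E) (hex : C.RightExact E) (n : ℕ)
    (L : C.Jet E n →ₗ[A] F) :
    (C.diffOfJet E F n L : E →ₗ[k] F) ∈ C.DiffLT E F n ↔ L ∘ₗ C.iotaJet E n = 0 := by
  cases n with
  | zero =>
    have diffOfJet_eq_zero : (C.diffOfJet E F 0 L : E →ₗ[k] F) = 0 ↔ L = 0 :=
      Submodule.coe_eq_zero.trans (map_eq_zero_iff _ (hel.diffOfJet_injective 0))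
    exact diffOfJet_eq_zero
  | succ n =>
    rw [← exists_comp_eq_iff_comp_eq_zero (hex n).1 (hex n).2]
    refine exists_congr fun L' => ⟨fun h => hel.ext fun e => ?_, ?_⟩
    · rw [LinearMap.comp_apply, piJet_jJet, ← h, diffOfJet_apply]
    · rintro rfl e
      rw [diffOfJet_apply, LinearMap.comp_apply, piJet_jJet]

variable (F) in
/-- The operators of order at most `n`, identified with the left linear maps on `J^n E`. -/
def Elemental.diffEquiv (hel : C.Elemental E) (n : ℕ) :
    (C.Jet E n →ₗ[A] F) ≃ₗ[k] C.Diff E F n :=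
  LinearEquiv.ofBijective (C.diffOfJet E F n) ⟨hel.diffOfJet_injective n, diffOfJet_surjective n⟩

variable (F) in
/-- The restriction symbol `L ∘ j^n ↦ L ∘ ι^n` of operators of order at most `n`. -/
def Elemental.restrictionSymbol (hel : C.Elemental E) (n : ℕ) :
    C.Diff E F n →ₗ[k] (C.Sym E n →ₗ[A] F) :=
  LinearMap.lcomp k F (C.iotaJet E n) ∘ₗ (hel.diffEquiv F n).symm.toLinearMap

theorem Elemental.restrictionSymbol_diffOfJet (hel : C.Elemental E) (n : ℕ)
    (L : C.Jet E n →ₗ[A] F) :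
    hel.restrictionSymbol F n (C.diffOfJet E F n L) = L ∘ₗ C.iotaJet E n :=
  congrArg (· ∘ₗ C.iotaJet E n) ((hel.diffEquiv F n).symm_apply_apply L)

theorem Elemental.ker_restrictionSymbol (hel : C.Elemental E) (hex : C.RightExact E) (n : ℕ) :
    LinearMap.ker (hel.restrictionSymbol F n) = (C.DiffLT E F n).submoduleOf (C.Diff E F n) := by
  ext Δ
  obtain ⟨L, rfl⟩ := diffOfJet_surjective n Δ
  rw [LinearMap.mem_ker, restrictionSymbol_diffOfJet, ← hel.diffOfJet_mem_diffLT_iff hex]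
  rfl

variable (F) in
/-- The embedding `Symb^n(E, F) → Hom_A(S^n E, F)` induced by the restriction symbol. -/
def Elemental.symbEmbedding (hel : C.Elemental E) (hex : C.RightExact E) (n : ℕ) :
    C.Symb E F n →ₗ[k] (C.Sym E n →ₗ[A] F) :=
  Submodule.liftQ _ (hel.restrictionSymbol F n) (hel.ker_restrictionSymbol hex n).ge

theorem Elemental.symbEmbedding_injective (hel : C.Elemental E) (hex : C.RightExact E) (n : ℕ) :
    Function.Injective (hel.symbEmbedding F hex n) :=
  LinearMap.ker_eq_bot.1
    (Submodule.ker_liftQ_eq_bot' _ _ (hel.ker_restrictionSymbol hex n).symm)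

theorem Elemental.symbEmbedding_zeta (hel : C.Elemental E) (hex : C.RightExact E) (n : ℕ)
    (L : C.Jet E n →ₗ[A] F) :
    hel.symbEmbedding F hex n (C.zeta E F n (C.diffOfJet E F n L)) = L ∘ₗ C.iotaJet E n :=
  hel.restrictionSymbol_diffOfJet n L

end Operators

section Quantization

variable {E : Type u} [AddCommGroup E] [Module A E] [Module k E]

theorem NaturalFullQuantization.toLinearMap_lof (q : C.NaturalFullQuantization E)
    (F : Type u) [AddCommGroup F] [Module A F] [Module k F] [IsScalarTower k A F] (n : ℕ)
    (τ : C.Symb E F n) :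
    q.toLinearMap F (DirectSum.lof k ℕ (fun n => C.Symb E F n) n τ) =
      Submodule.inclusion (le_iSup (C.Diff E F) n) ((q.component n).app F τ) :=
  DirectSum.toModule_lof k n τ

variable [IsScalarTower k A E]

/-- The natural quantization `Symb^n(E, F) → Hom_A(S^n E, F) → Hom_A(J^n E, F) → Diff^n(E, F)` given
by a left linear retraction `r` of `ι^n`. -/
def Elemental.quantizationOfRetraction (hel : C.Elemental E) (hex : C.RightExact E) {n : ℕ}
    (r : C.Jet E n →ₗ[A] C.Sym E n) (hr : r ∘ₗ C.iotaJet E n = LinearMap.id) :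
    C.NaturalQuantization E n where
  app F _ _ _ _ := C.diffOfJet E F n ∘ₗ LinearMap.lcomp k F r ∘ₗ hel.symbEmbedding F hex n
  zeta_app F _ _ _ _ τ := hel.symbEmbedding_injective hex n <| by
    rw [LinearMap.comp_apply, symbEmbedding_zeta, LinearMap.comp_apply, LinearMap.lcomp_apply',
      LinearMap.comp_assoc, hr, LinearMap.comp_id]
  naturality F G _ _ _ _ _ _ _ _ φ τ := by
    obtain ⟨Δ, rfl⟩ := Submodule.mkQ_surjective _ τ
    obtain ⟨L, rfl⟩ := diffOfJet_surjective n Δ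
    change C.diffOfJet E G n (hel.symbEmbedding G hex n (C.zeta E G n
      (C.diffMap E φ n (C.diffOfJet E F n L))) ∘ₗ r) = C.diffMap E φ n (C.diffOfJet E F n
        (hel.symbEmbedding F hex n (C.zeta E F n (C.diffOfJet E F n L)) ∘ₗ r))
    rw [diffMap_diffOfJet, diffMap_diffOfJet, symbEmbedding_zeta, symbEmbedding_zeta,
      LinearMap.comp_assoc, LinearMap.comp_assoc, LinearMap.comp_assoc]

theorem Elemental.quantizationOfRetraction_app_zeta (hel : C.Elemental E) (hex : C.RightExact E)
    {n : ℕ} (r : C.Jet E n →ₗ[A] C.Sym E n) (hr : r ∘ₗ C.iotaJet E n = LinearMap.id)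
    (F : Type u) [AddCommGroup F] [Module A F] [Module k F] [IsScalarTower k A F]
    (L : C.Jet E n →ₗ[A] F) :
    (hel.quantizationOfRetraction hex r hr).app F (C.zeta E F n (C.diffOfJet E F n L)) =
      C.diffOfJet E F n (L ∘ₗ C.iotaJet E n ∘ₗ r) := by
  rw [← LinearMap.comp_assoc, ← hel.symbEmbedding_zeta hex n L]
  rfl

theorem IsRetraction.exists_isInducedQuantization
    {t : ∀ n : ℕ, C.FormT (C.Sym E n) 1 →ₗ[A] C.Sym E (n + 1)} (ht : C.IsRetraction E t)
    (hel : C.Elemental E) (hex : C.RightExact E) (N : ∀ n : ℕ, C.LeftConnection (C.Sym E n)) :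
    ∃ q : C.NaturalFullQuantization E, C.IsInducedQuantization t N q := by
  refine ⟨⟨fun n => hel.quantizationOfRetraction hex (iterJetLift t N n)
    (ht.iterJetLift_comp_iotaJet N n)⟩, fun n F _ _ _ _ Δ L hL e => ?_⟩
  obtain rfl := diffOfJet_eq hL
  rw [NaturalFullQuantization.toLinearMap_lof, hel.quantizationOfRetraction_app_zeta,
    ← iterJetLift_jJet]
  rfl

end Quantization

end ExteriorCalculus

end NCJet

end

theorem corollary5p18 {k : Type w} {A Ω : Type u} [CommRing k] [Ring A] [Algebra k A]
    [Ring Ω] [Algebra k Ω] (C : NCJet.ExteriorCalculus k A Ω)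
    (E : Type u) [AddCommGroup E] [Module A E] [Module k E] [IsScalarTower k A E]
    (hel : C.Elemental E) (hex : C.RightExact E)
    (D : C.BimoduleConnection) (N₀ : C.LeftConnection E) :
    (∀ t : ∀ n : ℕ, C.FormT (C.Sym E n) 1 →ₗ[A] C.Sym E (n + 1), C.IsRetraction E t →
      ∃ N : ∀ n : ℕ, C.LeftConnection (C.Sym E n), C.IsInducedConnection D N₀ t N ∧
        ∃ q : C.NaturalFullQuantization E, C.IsInducedQuantization t N q) ∧
    (∀ s : ∀ n : ℕ, C.FormT (C.Sym A n) 1 →ₗ[A] C.Sym A (n + 1),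
      C.IsRetraction A s → C.IsRightLinear s → C.SymGenerated E →
      ∃ t : ∀ n : ℕ, C.FormT (C.Sym E n) 1 →ₗ[A] C.Sym E (n + 1),
        C.IsTensor s t ∧ (∀ t', C.IsTensor s t' → t' = t) ∧ C.IsRetraction E t ∧
        ∃ N : ∀ n : ℕ, C.LeftConnection (C.Sym E n), C.IsInducedConnection D N₀ t N ∧
          ∃ q : C.NaturalFullQuantization E, C.IsInducedQuantization t N q) := by
  have part_one (t : ∀ n : ℕ, C.FormT (C.Sym E n) 1 →ₗ[A] C.Sym E (n + 1))
      (ht : C.IsRetraction E t) :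
      ∃ N : ∀ n : ℕ, C.LeftConnection (C.Sym E n), C.IsInducedConnection D N₀ t N ∧
        ∃ q : C.NaturalFullQuantization E, C.IsInducedQuantization t N q :=
    ⟨_, NCJet.ExteriorCalculus.isInducedConnection_symConnection D N₀ ht,
      ht.exists_isInducedQuantization hel hex _⟩
  refine ⟨part_one, fun s hs hr hgen => ?_⟩
  obtain ⟨t, ht⟩ := hs.exists_isTensor hr hgen
  have ht_retraction : C.IsRetraction E t := ht.isRetraction hs hgen
  exact ⟨t, ht, fun t' ht' => ht'.eq hgen ht, ht_retraction, part_one t ht_retraction⟩
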